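/- Let $M\subset\mathbb{R}^n$ be open and connected. Let $f_0,f_1,\dots,f_k$ be smooth vector fields on $M$ and let $g:M\to\mathbb{R}^{n\times d}$ be smooth. Write $\mathrm{Sym}(n)$ for the space of symmetric $n\times n$ matrices, $\mathrm{Sym}^+(n)$ for the set of positive definite ones, and $Df$ for the Jacobian matrix of a vector field $f$. Consider the statistical linearization of the control-affine stochastic system $dx=\big(f_0(x)+\sum_{i=1}^k u_if_i(x)\big)\,dt+g(x)\,dW_t$, that is, the control system on $M\times\mathrm{Sym}^+(n)$ $$\dot X=F_{f_0,g}(X)+\sum_{i=1}^k u_i\,F_{f_i}(X),\qquad X=(m,P)\in M\times\mathrm{Sym}^+(n),\quad u\in\mathbb{R}^k,$$ where $$F_{f_0,g}(m,P)=\big(f_0(m),\ Df_0(m)P+P\,Df_0(m)^\top+g(m)g(m)^\top\big),\qquad F_{f_i}(m,P)=\big(f_i(m),\ Df_i(m)P+P\,Df_i(m)^\top\big).$$ For $X\in M\times\mathrm{Sym}^+(n)$ and $T\ge 0$, let $\mathcal A(X,T)$ be the set of points reached from $X$ in time exactly $T$ by trajectories of this system that stay in $M\times\mathrm{Sym}^+(n)$,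 with piecewise constant controls $u:[0,T]\to\mathbb{R}^k$, and let $\mathcal A(X)=\bigcup_{T\ge0}\mathcal A(X,T)$. Let $\mathrm{Lie}(f_1,\dots,f_k)$ be the linear span of all iterated Lie brackets $[f_{i_1},\dots,[f_{i_{r-1}},f_{i_r}]]$, $r\ge1$, $i_1,\dots,i_r\in\{1,\dots,k\}$. Suppose that for every $m\in M$ $$\dim\big\{\big(f(m),\,Df(m)+Df(m)^\top\big)\ :\ f\in\mathrm{Lie}(f_1,\dots,f_k)\big\}=n+\frac{n(n+1)}2,$$ that is, these vectors fill $\mathbb{R}^n\times\mathrm{Sym}(n)$. Then the system is controllable on $M\times\mathrm{Sym}^+(n)$ in free and fixed time: for every $X\in M\times\mathrm{Sym}^+(n)$ one has $\mathcal A(X)=M\times\mathrm{Sym}^+(n)$, and there is $T_0>0$ such that $\mathcal A(X,T)=M\times\mathrm{Sym}^+(n)$ for all $0<T<T_0$. -/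

import Mathlib

open scoped ContDiff

namespace StatLin

/-- `IteratedBracket S V`: the vector field `V` on `ℝⁿ` is an iterated Lie bracket
`[f₁, …, [f_{k-1}, f_k]]`, `k ≥ 1`, of elements `f_i` of the family `S`. -/
inductive IteratedBracket {n : ℕ} (S : Set ((Fin n → ℝ) → (Fin n → ℝ))) :
    ((Fin n → ℝ) → (Fin n → ℝ)) → Prop
  | of {V : (Fin n → ℝ) → (Fin n → ℝ)} (hV : V ∈ S) : IteratedBracket S V
  | bracket {V W : (Fin n → ℝ) → (Fin n → ℝ)} (hV : V ∈ S) (hW : IteratedBracket S W) :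
      IteratedBracket S (VectorField.lieBracket ℝ V W)

/-- The Lie algebra of vector fields generated by the family `S`: the linear span of the iterated
brackets of elements of `S`. (For fields that are smooth on an open set `M`, the values and the
derivatives on `M` of its elements depend only on the restrictions to `M` of the fields in `S`.) -/
def lieAlgebraGen {n : ℕ} (S : Set ((Fin n → ℝ) → (Fin n → ℝ))) :
    Submodule ℝ ((Fin n → ℝ) → (Fin n → ℝ)) :=
  Submodule.span ℝ {V | IteratedBracket S V}

/-- The Jacobian matrix `Df(m)`. -/
noncomputable def jacobian {n : ℕ} (f : (Fin n → ℝ) → (Fin n → ℝ)) (m : Fin n → ℝ) :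
    Matrix (Fin n) (Fin n) ℝ :=
  LinearMap.toMatrix' (fderiv ℝ f m : (Fin n → ℝ) →ₗ[ℝ] (Fin n → ℝ))

/-- The subspace of `ℝⁿ × Sym(n)` spanned by the vectors `(f(m), Df(m) + Df(m)ᵀ)`, where `f` runs
through the Lie algebra generated by the family `S`. -/
noncomputable def lieOneJet {n : ℕ} (S : Set ((Fin n → ℝ) → (Fin n → ℝ))) (m : Fin n → ℝ) :
    Submodule ℝ ((Fin n → ℝ) × Matrix (Fin n) (Fin n) ℝ) :=
  Submodule.span ℝ
    {v | ∃ f ∈ lieAlgebraGen S, v = (f m, jacobian f m + (jacobian f m).transpose)}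

/-- The state space `M × Sym⁺(n)`, where `Sym⁺(n)` is the set of symmetric positive definite
matrices. -/
def stateSpace {n : ℕ} (M : Set (Fin n → ℝ)) : Set ((Fin n → ℝ) × Matrix (Fin n) (Fin n) ℝ) :=
  {X | X.1 ∈ M ∧ X.2.PosDef}

/-- `F_f(m, P) = (f(m), Df(m) P + P Df(m)ᵀ)`. -/
noncomputable def controlField {n : ℕ} (f : (Fin n → ℝ) → (Fin n → ℝ))
    (X : (Fin n → ℝ) × Matrix (Fin n) (Fin n) ℝ) : (Fin n → ℝ) × Matrix (Fin n) (Fin n) ℝ :=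
  (f X.1, jacobian f X.1 * X.2 + X.2 * (jacobian f X.1).transpose)

/-- `F_{f,g}(m, P) = (f(m), Df(m) P + P Df(m)ᵀ + g(m) g(m)ᵀ)`. -/
noncomputable def driftField {n d : ℕ} (f : (Fin n → ℝ) → (Fin n → ℝ))
    (g : (Fin n → ℝ) → Matrix (Fin n) (Fin d) ℝ)
    (X : (Fin n → ℝ) × Matrix (Fin n) (Fin n) ℝ) : (Fin n → ℝ) × Matrix (Fin n) (Fin n) ℝ :=
  (f X.1, jacobian f X.1 * X.2 + X.2 * (jacobian f X.1).transpose + g X.1 * (g X.1).transpose)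

/-- The right-hand side `F_{f₀,g}(X) + ∑ᵢ uᵢ F_{fᵢ}(X)` of the statistical linearization of the
stochastic control system `dx = (f₀(x) + ∑ᵢ uᵢ fᵢ(x)) dt + g(x) dW`. -/
noncomputable def statLinearization {n d k : ℕ} (f₀ : (Fin n → ℝ) → (Fin n → ℝ))
    (f : Fin k → (Fin n → ℝ) → (Fin n → ℝ)) (g : (Fin n → ℝ) → Matrix (Fin n) (Fin d) ℝ)
    (X : (Fin n → ℝ) × Matrix (Fin n) (Fin n) ℝ) (u : Fin k → ℝ) :
    (Fin n → ℝ) × Matrix (Fin n) (Fin n) ℝ :=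
  driftField f₀ g X + ∑ i, u i • controlField (f i) X

/-- `X` is a trajectory on `[0, T]`, inside `Ω`, of the control system `Ẋ = F(X, u)` for the
piecewise constant control `u`: it is continuous on `[0, T]`, and away from a finite set of times
`u` is locally constant and the differential equation holds. -/
structure IsTrajectory {n k : ℕ} (Ω : Set ((Fin n → ℝ) × Matrix (Fin n) (Fin n) ℝ))
    (F : (Fin n → ℝ) × Matrix (Fin n) (Fin n) ℝ → (Fin k → ℝ) →
      (Fin n → ℝ) × Matrix (Fin n) (Fin n) ℝ)
    (T : ℝ) (u : ℝ → Fin k → ℝ) (X : ℝ → (Fin n → ℝ) × Matrix (Fin n) (Fin n) ℝ) : Prop where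
  continuousOn : ContinuousOn X (Set.Icc 0 T)
  mem : ∀ t ∈ Set.Icc 0 T, X t ∈ Ω
  piecewise : ∃ s : Finset ℝ, ∀ t ∈ Set.Ioo 0 T, t ∉ s →
    (∀ᶠ r in nhds t, u r = u t) ∧ HasDerivAt X (F (X t) (u t)) t

/-- The reachable set `A(x, T)` from `x` in time exactly `T`. -/
def reachableSet {n k : ℕ} (Ω : Set ((Fin n → ℝ) × Matrix (Fin n) (Fin n) ℝ))
    (F : (Fin n → ℝ) × Matrix (Fin n) (Fin n) ℝ → (Fin k → ℝ) →
      (Fin n → ℝ) × Matrix (Fin n) (Fin n) ℝ)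
    (x : (Fin n → ℝ) × Matrix (Fin n) (Fin n) ℝ) (T : ℝ) :
    Set ((Fin n → ℝ) × Matrix (Fin n) (Fin n) ℝ) :=
  {y | ∃ (u : ℝ → Fin k → ℝ) (X : ℝ → (Fin n → ℝ) × Matrix (Fin n) (Fin n) ℝ),
    IsTrajectory Ω F T u X ∧ X 0 = x ∧ X T = y}

/-- Controllability on `Ω` in free and fixed time: for every `x ∈ Ω`, `⋃_{T ≥ 0} A(x, T) = Ω`, and
`A(x, T) = Ω` for all sufficiently small `T > 0`. -/
def ControllableFreeAndFixedTime {n k : ℕ}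
    (Ω : Set ((Fin n → ℝ) × Matrix (Fin n) (Fin n) ℝ))
    (F : (Fin n → ℝ) × Matrix (Fin n) (Fin n) ℝ → (Fin k → ℝ) →
      (Fin n → ℝ) × Matrix (Fin n) (Fin n) ℝ) : Prop :=
  ∀ x ∈ Ω, (⋃ T ∈ Set.Ici (0 : ℝ), reachableSet Ω F x T) = Ω ∧
    ∃ T₀ : ℝ, 0 < T₀ ∧ ∀ T : ℝ, 0 < T → T < T₀ → reachableSet Ω F x T = Ω

end StatLin

set_option linter.unusedSectionVars false

/-! Large controls make the drift negligible. An arc of `ε • drift + θ • ctrl i` on `[0, 1]`, run in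
time `ε`, is a trajectory with control `θ / ε`. So it suffices to join points with the driftless
system, which is reversible, and then to show that the connection survives a small `ε`.

The states `(m, P)` are lifted to frames `(m, A)` with `P = A Aᵀ`. A field `W` lifts to `(W(m),
DW(m) A)`, and brackets lift to brackets (`lieBracket_lift`). The right rotations `A (B - Bᵀ)`
project to zero, so adding them as controls changes nothing below. They supply the skew directions
and the rank hypothesis supplies the symmetric ones, so every direction at `(m, 1)` is available
(`directions_eq_top`).

Availability is expressed through loops: `w` is a steering direction at `x` if some parametrized
family of chains closes up at `x`, has identity derivative in the initial point and produces `w` by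
varying the parameter. Conjugating such a loop by a control flow and differentiating at time zero
shows stability under bracketing with control fields (`lieBracket_mem_directions`). When all
directions occur, the open mapping theorem makes the orbit a neighbourhood (`eventually_orbit`).
Carrying `ε` as a further variable, it also gives exact steering for every small `ε`
(`exists_chain_of_orbit`).

Globally, lifted control fields commute with right multiplication of frames, and rotations only
change `A` by an orthogonal factor. Local orbits can therefore be translated. Connectedness of `M`
and convexity of the positive definite cone then join all states (`exists_orbit_of_posDef`). -/

namespace AffineControl

open Filter Topology Set

universe u

/-! ### Smoothness of superposition operators on spaces of continuous curves. -/

section Superposition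

variable {K : Type*} [TopologicalSpace K] [CompactSpace K]
variable {V : Type*} [NormedAddCommGroup V] [NormedSpace ℝ V]
variable {W : Type*} [NormedAddCommGroup W] [NormedSpace ℝ W]

open Classical in
/-- The superposition operator `γ ↦ F ∘ γ` on continuous maps (zero if `F ∘ γ` is not
continuous). -/
noncomputable def superposition (F : V → W) (γ : C(K, V)) : C(K, W) :=
  if h : Continuous (F ∘ γ) then ⟨F ∘ γ, h⟩ else 0

lemma superposition_apply {F : V → W} {U : Set V} (hF : ContinuousOn F U) {γ : C(K, V)}
    (hγ : ∀ t, γ t ∈ U) (t : K) : superposition F γ t = F (γ t) := by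
  have h : Continuous (F ∘ γ) := hF.comp_continuous γ.continuous hγ
  simp [superposition, h]

/-- Pointwise application of a continuous family of linear maps to a continuous map. -/
noncomputable def pointwiseApply :
    C(K, V →L[ℝ] W) →L[ℝ] C(K, V) →L[ℝ] C(K, W) :=
  LinearMap.mkContinuous₂
    (LinearMap.mk₂ ℝ (fun (A : C(K, V →L[ℝ] W)) (η : C(K, V)) =>
        (⟨fun t => A t (η t), A.continuous.clm_apply η.continuous⟩ : C(K, W)))
      (fun A B η => by ext t; simp) (fun c A η => by ext t; simp)
      (fun A η ξ => by ext t; simp) (fun c A η => by ext t; simp)) 1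
    (fun A η => by
      rw [one_mul, ContinuousMap.norm_le _ (by positivity)]
      intro t
      exact (ContinuousLinearMap.le_opNorm _ _).trans
        (by gcongr; exacts [A.norm_coe_le_norm t, η.norm_coe_le_norm t]))

@[simp] lemma pointwiseApply_apply (A : C(K, V →L[ℝ] W)) (η : C(K, V)) (t : K) :
    pointwiseApply A η t = A t (η t) := rfl

lemma isOpen_forall_mem {U : Set V} (hU : IsOpen U) : IsOpen {γ : C(K, V) | ∀ t, γ t ∈ U} := by
  have := ContinuousMap.isOpen_setOfPred_mapsTo (X := K) (Y := V) isCompact_univ hU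
  simpa [MapsTo] using this

/-- Strict differentiability at `γ t₀` and continuity of the derivative control the remainder for
`t` near `t₀`; compactness of `K` makes this uniform, as the sup norm requires. -/
lemma eventually_forall_norm_sub_le {F : V → W} {U : Set V} (hU : IsOpen U)
    (hF : ContDiffOn ℝ 1 F U) (γ : C(K, V)) (hγ : ∀ t, γ t ∈ U) {c : ℝ} (hc : 0 < c) :
    ∀ᶠ h in 𝓝 (0 : V), ∀ t : K,
      ‖F (γ t + h) - F (γ t) - fderiv ℝ F (γ t) h‖ ≤ c * ‖h‖ := by
  have key := isCompact_univ.eventually_forall_of_forall_eventually (X := V) (Y := K) (x₀ := 0)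
    (P := fun h t => ‖F (γ t + h) - F (γ t) - fderiv ℝ F (γ t) h‖ ≤ c * ‖h‖) ?_
  · filter_upwards [key] with h hh t using hh t (mem_univ t)
  intro t₀ _
  have hat : ContDiffAt ℝ 1 F (γ t₀) := hF.contDiffAt (hU.mem_nhds (hγ t₀))
  have hs := hat.hasStrictFDerivAt one_ne_zero
  have h1 := hs.isLittleO.def (half_pos hc)
  have hfc : ContinuousAt (fderiv ℝ F) (γ t₀) :=
    (hF.continuousOn_fderiv_of_isOpen hU le_rfl).continuousAt (hU.mem_nhds (hγ t₀))
  have h2 : ∀ᶠ z in 𝓝 (γ t₀), ‖fderiv ℝ F z - fderiv ℝ F (γ t₀)‖ < c / 2 := by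
    have := Metric.tendsto_nhds.1 hfc (c / 2) (half_pos hc)
    simpa [dist_eq_norm] using this
  have c1 : Tendsto (fun p : V × K => (γ p.2 + p.1, γ p.2)) (𝓝 (0, t₀)) (𝓝 (γ t₀, γ t₀)) := by
    have : Continuous (fun p : V × K => (γ p.2 + p.1, γ p.2)) := by fun_prop
    simpa using this.tendsto (0, t₀)
  have c2 : Tendsto (fun p : V × K => γ p.2) (𝓝 (0, t₀)) (𝓝 (γ t₀)) := by
    have : Continuous (fun p : V × K => γ p.2) := by fun_prop
    simpa using this.tendsto (0, t₀)
  filter_upwards [c1.eventually h1, c2.eventually h2] with p hp1 hp2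
  simp only [add_sub_cancel_left] at hp1
  have e : F (γ p.2 + p.1) - F (γ p.2) - fderiv ℝ F (γ p.2) p.1
      = (F (γ p.2 + p.1) - F (γ p.2) - fderiv ℝ F (γ t₀) p.1)
        - (fderiv ℝ F (γ p.2) - fderiv ℝ F (γ t₀)) p.1 := by
    simp
  rw [e]
  calc _ ≤ _ := norm_sub_le _ _
    _ ≤ c / 2 * ‖p.1‖ + c / 2 * ‖p.1‖ := by
      gcongr
      exact (ContinuousLinearMap.le_opNorm _ _).trans (by gcongr)
    _ = c * ‖p.1‖ := by ring

lemma hasFDerivAt_superposition {F : V → W} {U : Set V} (hU : IsOpen U)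
    (hF : ContDiffOn ℝ 1 F U) (γ : C(K, V)) (hγ : ∀ t, γ t ∈ U) :
    HasFDerivAt (superposition (K := K) F) (pointwiseApply (superposition (fderiv ℝ F) γ)) γ := by
  have hFc := hF.continuousOn
  have hdF := hF.continuousOn_fderiv_of_isOpen hU le_rfl
  refine HasFDerivAt.of_isLittleO (Asymptotics.isLittleO_iff.2 fun c hc => ?_)
  obtain ⟨δ, hδ, H⟩ := Metric.eventually_nhds_iff.1
    (eventually_forall_norm_sub_le hU hF γ hγ hc)
  filter_upwards [(isOpen_forall_mem hU).mem_nhds hγ, Metric.ball_mem_nhds γ hδ] with γ' h1 h2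
  rw [ContinuousMap.norm_le _ (by positivity)]
  intro t
  have hle : ‖γ' t - γ t‖ ≤ ‖γ' - γ‖ := (γ' - γ).norm_coe_le_norm t
  have hd : dist (γ' t - γ t) 0 < δ := by
    rw [dist_zero_right]
    exact hle.trans_lt (by simpa [dist_eq_norm] using h2)
  have := H hd t
  simp only [ContinuousMap.sub_apply, pointwiseApply_apply, superposition_apply hFc hγ,
    superposition_apply hFc h1, superposition_apply hdF hγ]
  rw [add_sub_cancel] at this
  exact this.trans (by gcongr)

/-- The derivative is `pointwiseApply` after the superposition operator of `fderiv ℝ F`, so one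
induction step replaces `W` by `V →L[ℝ] W`. This is why `W` is quantified inside, in the universe of
`V`. -/
theorem contDiffOn_superposition {V : Type u} [NormedAddCommGroup V] [NormedSpace ℝ V]
    {U : Set V} (hU : IsOpen U) (n : ℕ) : ∀ {W : Type u} [NormedAddCommGroup W] [NormedSpace ℝ W]
    {F : V → W}, ContDiffOn ℝ ∞ F U →
    ContDiffOn ℝ n (superposition (K := K) F) {γ : C(K, V) | ∀ t, γ t ∈ U} := by
  induction n with
  | zero =>
    intro W _ _ F hF
    rw [Nat.cast_zero, contDiffOn_zero]
    intro γ hγ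
    exact (hasFDerivAt_superposition hU (hF.of_le (by simp)) γ hγ).continuousAt.continuousWithinAt
  | succ n ih =>
    intro W _ _ F hF
    rw [Nat.cast_add, Nat.cast_one, contDiffOn_succ_iff_fderiv_of_isOpen (isOpen_forall_mem hU)]
    have hd := fun γ hγ => hasFDerivAt_superposition (K := K) hU (hF.of_le (by simp)) γ hγ
    refine ⟨fun γ hγ => (hd γ hγ).differentiableAt.differentiableWithinAt, by simp, ?_⟩
    have h2 := ih (hF.fderiv_of_isOpen hU (m := ∞) (by simp))
    have h3 := (pointwiseApply (K := K) (V := V) (W := W)).contDiff (n := n) |>.comp_contDiffOn h2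
    exact h3.congr fun γ hγ => (hd γ hγ).fderiv

end Superposition

end AffineControl

namespace AffineControl

open Filter Topology Set unitInterval MeasureTheory

/-! ### Local flows from the implicit function theorem. -/

section LocalFlow

variable {V : Type*} [NormedAddCommGroup V] [NormedSpace ℝ V]

/-- The Volterra operator `η ↦ ∫₀ᵗ η` on continuous curves. -/
noncomputable def volterra [CompleteSpace V] : C(I, V) →L[ℝ] C(I, V) :=
  LinearMap.mkContinuous
    { toFun := fun η => ⟨fun t => ∫ s in (0 : ℝ)..t, IccExtend zero_le_one η s, by
        have h : Continuous (IccExtend (zero_le_one (α := ℝ)) η) := η.continuous.Icc_extend'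
        exact (intervalIntegral.continuous_primitive
          (fun a b => h.intervalIntegrable a b) 0).comp continuous_subtype_val⟩
      map_add' := fun η ξ => by
        ext t
        have h : Continuous (IccExtend (zero_le_one (α := ℝ)) η) := η.continuous.Icc_extend'
        have h' : Continuous (IccExtend (zero_le_one (α := ℝ)) ξ) := ξ.continuous.Icc_extend'
        exact intervalIntegral.integral_add (h.intervalIntegrable 0 t) (h'.intervalIntegrable 0 t)
      map_smul' := fun c η => by
        ext t
        exact intervalIntegral.integral_smul c _ } 1
    (fun η => by
      rw [one_mul, ContinuousMap.norm_le _ (by positivity)]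
      intro t
      refine (intervalIntegral.norm_integral_le_of_norm_le_const
        (C := ‖η‖) fun s _ => η.norm_coe_le_norm _).trans ?_
      rw [sub_zero, abs_of_nonneg t.2.1]
      exact mul_le_of_le_one_right (norm_nonneg _) t.2.2)

/-- There is an integral curve of `Z` in `U`, defined on `[0, 1]`, from `x` to `y`. -/
def Arc (U : Set V) (Z : V → V) (x y : V) : Prop :=
  ∃ γ : ℝ → V, γ 0 = x ∧ γ 1 = y ∧
    ∀ t ∈ Icc (0 : ℝ) 1, γ t ∈ U ∧ HasDerivWithinAt γ (Z (γ t)) (Icc 0 1) t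

lemma arc_of_integral_eq [CompleteSpace V] {U : Set V} {Z : V → V} (hZ : ContinuousOn Z U)
    {x : V} {γ : C(I, V)} (hγ : ∀ t, γ t ∈ U)
    (h : ∀ t, γ t = x + volterra (superposition Z γ) t) : Arc U Z x (γ 1) := by
  set η := superposition Z γ with hη
  have hc : Continuous (IccExtend (zero_le_one (α := ℝ)) η) := η.continuous.Icc_extend'
  refine ⟨fun t => x + ∫ s in (0 : ℝ)..t, IccExtend zero_le_one η s, by simp, (h 1).symm, ?_⟩
  intro t ht
  have e : x + ∫ s in (0 : ℝ)..t, IccExtend zero_le_one η s = γ ⟨t, ht⟩ := (h ⟨t, ht⟩).symm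
  have hd := ((hc.integral_hasStrictDerivAt 0 t).hasDerivAt.const_add x).hasDerivWithinAt
    (s := Icc 0 1)
  beta_reduce
  rw [e]
  refine ⟨hγ _, ?_⟩
  rwa [IccExtend_of_mem _ _ ht, hη, superposition_apply hZ hγ] at hd

/-- The integral equation of the arc is an equation `H = 0` in `C(I, V)`, solved by the implicit
function theorem near the constant curve. Time is absorbed in the coefficients of `X` and `Y`. Class
`C²` is kept because brackets are read off second derivatives of the flow. -/
theorem exists_localFlow [CompleteSpace V] {U : Set V} (hU : IsOpen U) {X Y : V → V}
    (hX : ContDiffOn ℝ ∞ X U) (hY : ContDiffOn ℝ ∞ Y U) {x₀ : V} (hx₀ : x₀ ∈ U) :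
    ∃ G : V × ℝ × ℝ → V, ContDiffAt ℝ 2 G (x₀, 0, 0) ∧
      ∀ᶠ q in 𝓝 (x₀, (0 : ℝ), (0 : ℝ)), Arc U (q.2.1 • X + q.2.2 • Y) q.1 (G q) := by
  let c₀ : C(I, V) := ContinuousMap.const I x₀
  let κ : V →L[ℝ] C(I, V) := ContinuousLinearMap.const ℝ I
  let H : (V × ℝ × ℝ) × C(I, V) → C(I, V) := fun p =>
    p.2 - κ p.1.1 - p.1.2.1 • volterra (superposition X p.2)
      - p.1.2.2 • volterra (superposition Y p.2)
  let u : (V × ℝ × ℝ) × C(I, V) := ((x₀, 0, 0), c₀)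
  have hc₀ : ∀ t, c₀ t ∈ U := fun _ => hx₀
  have hSX : ContDiffAt ℝ 2 (superposition (K := I) X) u.2 :=
    (contDiffOn_superposition hU 2 hX).contDiffAt ((isOpen_forall_mem hU).mem_nhds hc₀)
  have hSY : ContDiffAt ℝ 2 (superposition (K := I) Y) u.2 :=
    (contDiffOn_superposition hU 2 hY).contDiffAt ((isOpen_forall_mem hU).mem_nhds hc₀)
  have hVX : ContDiffAt ℝ 2 (fun p : (V × ℝ × ℝ) × C(I, V) => volterra (superposition X p.2)) u :=
    (volterra (V := V)).contDiff.contDiffAt.comp u (hSX.comp u contDiffAt_snd)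
  have hVY : ContDiffAt ℝ 2 (fun p : (V × ℝ × ℝ) × C(I, V) => volterra (superposition Y p.2)) u :=
    (volterra (V := V)).contDiff.contDiffAt.comp u (hSY.comp u contDiffAt_snd)
  have hκ : ContDiff ℝ 2 κ := κ.contDiff
  have hH : ContDiffAt ℝ 2 H u := by
    have a1 : ContDiffAt ℝ 2 (fun p : (V × ℝ × ℝ) × C(I, V) => κ p.1.1) u := by fun_prop
    have a2 : ContDiffAt ℝ 2 (fun p : (V × ℝ × ℝ) × C(I, V) => p.1.2.1) u := by fun_prop
    have a3 : ContDiffAt ℝ 2 (fun p : (V × ℝ × ℝ) × C(I, V) => p.1.2.2) u := by fun_prop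
    exact ((contDiffAt_snd.sub a1).sub (a2.smul hVX)).sub (a3.smul hVY)
  -- At zero coefficients the integral terms vanish, so `H` depends on the curve by a translation.
  have hinr : fderiv ℝ H u ∘L .inr ℝ (V × ℝ × ℝ) C(I, V) = .id ℝ _ := by
    have h1 : HasFDerivAt (fun γ : C(I, V) => H (u.1, γ))
        (fderiv ℝ H u ∘L .inr ℝ (V × ℝ × ℝ) C(I, V)) u.2 :=
      (hH.differentiableAt (by norm_num)).hasFDerivAt.comp u.2 (hasFDerivAt_prodMk_right u.1 u.2)
    have h2 : HasFDerivAt (fun γ : C(I, V) => H (u.1, γ)) (.id ℝ _) u.2 := by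
      have : (fun γ : C(I, V) => H (u.1, γ)) = fun γ => γ - κ x₀ := by
        ext γ; simp [H, u]
      rw [this]
      exact (hasFDerivAt_id _).sub_const _
    exact h1.unique h2
  have hinv : (fderiv ℝ H u ∘L .inr ℝ (V × ℝ × ℝ) C(I, V)).IsInvertible := by
    rw [hinr]; exact ⟨.refl ℝ _, rfl⟩
  set ψ := hH.implicitFunction two_ne_zero hinv with hψ
  have hψs : ContDiffAt ℝ 2 ψ u.1 := hH.contDiffAt_implicitFunction two_ne_zero hinv
  have hψ0 : ψ u.1 = c₀ := hH.implicitFunction_apply_self two_ne_zero hinv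
  have hψe : ∀ᶠ q in 𝓝 u.1, H (q, ψ q) = H u :=
    hH.eventually_apply_implicitFunction two_ne_zero hinv
  have hHu : H u = 0 := by
    ext t; simp [H, u, c₀, κ]
  refine ⟨fun q => ψ q 1, ?_, ?_⟩
  · exact (ContinuousMap.evalCLM ℝ (1 : I)).contDiff.contDiffAt.comp _ hψs
  · have hmem : ∀ᶠ q in 𝓝 u.1, ∀ t, ψ q t ∈ U :=
      hψs.continuousAt.eventually ((isOpen_forall_mem hU).mem_nhds (by rw [hψ0]; exact hc₀))
    filter_upwards [hψe, hmem] with q hq hqU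
    have hZ : ContinuousOn (q.2.1 • X + q.2.2 • Y) U :=
      (hX.continuousOn.const_smul _).add (hY.continuousOn.const_smul _)
    refine arc_of_integral_eq hZ hqU fun t => ?_
    have hs : superposition (q.2.1 • X + q.2.2 • Y) (ψ q)
        = q.2.1 • superposition X (ψ q) + q.2.2 • superposition Y (ψ q) := by
      ext s
      simp [superposition_apply hZ hqU, superposition_apply hX.continuousOn hqU,
        superposition_apply hY.continuousOn hqU]
    have := DFunLike.congr_fun (hq.trans hHu) t
    simp only [H, ContinuousMap.sub_apply, ContinuousMap.smul_apply, ContinuousMap.zero_apply] at this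
    rw [hs, map_add, map_smul, map_smul, ContinuousMap.add_apply, ContinuousMap.smul_apply,
      ContinuousMap.smul_apply]
    have e : κ q.1 t = q.1 := rfl
    rw [e, sub_sub, sub_sub, sub_eq_zero] at this
    exact this

end LocalFlow

end AffineControl

namespace AffineControl

open Filter Topology Set

/-! ### Arcs, chains and orbits. -/

section Arc

variable {V : Type*} [NormedAddCommGroup V] [NormedSpace ℝ V] {U : Set V} {Z : V → V}

/-- Affine reparametrization; `t < s` is allowed and gives time reversal. -/
lemma arc_of_hasDerivWithinAt {γ : ℝ → V}
    (hγ : ∀ t ∈ Icc (0 : ℝ) 1, γ t ∈ U ∧ HasDerivWithinAt γ (Z (γ t)) (Icc 0 1) t)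
    {s t : ℝ} (hs : s ∈ Icc (0 : ℝ) 1) (ht : t ∈ Icc (0 : ℝ) 1) :
    Arc U ((t - s) • Z) (γ s) (γ t) := by
  have hmaps : MapsTo (fun τ : ℝ => s + τ * (t - s)) (Icc 0 1) (Icc 0 1) := by
    intro τ hτ
    have e : s + τ * (t - s) = (1 - τ) * s + τ * t := by ring
    refine ⟨?_, ?_⟩
    · beta_reduce; rw [e]; have := hτ.1; have := hτ.2; have := hs.1; have := ht.1
      exact add_nonneg (mul_nonneg (by linarith) hs.1) (mul_nonneg hτ.1 ht.1)
    · show s + τ * (t - s) ≤ 1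
      rw [e]; nlinarith [hτ.1, hτ.2, hs.2, ht.2]
  refine ⟨fun τ => γ (s + τ * (t - s)), by simp, by simp, fun τ hτ => ⟨(hγ _ (hmaps hτ)).1, ?_⟩⟩
  have h1 : HasDerivWithinAt (fun τ : ℝ => s + τ * (t - s)) (t - s) (Icc 0 1) τ := by
    simpa using (((hasDerivAt_id τ).mul_const (t - s)).const_add s).hasDerivWithinAt
  exact (hγ _ (hmaps hτ)).2.scomp τ h1 hmaps

lemma Arc.left_mem {x y : V} (h : Arc U Z x y) : x ∈ U := by
  obtain ⟨γ, rfl, -, hγ⟩ := h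
  exact (hγ 0 (by simp)).1

lemma Arc.right_mem {x y : V} (h : Arc U Z x y) : y ∈ U := by
  obtain ⟨γ, -, rfl, hγ⟩ := h
  exact (hγ 1 (by simp)).1

lemma Arc.symm {x y : V} (h : Arc U Z x y) : Arc U (-Z) y x := by
  obtain ⟨γ, rfl, rfl, hγ⟩ := h
  simpa using arc_of_hasDerivWithinAt hγ (s := 1) (t := 0) (by simp) (by simp)

lemma arc_zero {x : V} (hx : x ∈ U) : Arc U (0 : V → V) x x :=
  ⟨fun _ => x, rfl, rfl, fun t _ => ⟨hx, by simpa using hasDerivWithinAt_const t _ x⟩⟩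

/-- The two curves fill a compact subset of `U`, on which the locally Lipschitz field `Z` is
Lipschitz, so Grönwall uniqueness applies. -/
lemma Arc.unique (hU : IsOpen U) (hZ : ContDiffOn ℝ 1 Z U) {x y y' : V} (h : Arc U Z x y)
    (h' : Arc U Z x y') : y = y' := by
  obtain ⟨γ, h0, rfl, hγ⟩ := h
  obtain ⟨γ', h0', rfl, hγ'⟩ := h'
  have hc : ContinuousOn γ (Icc 0 1) := fun t ht => (hγ t ht).2.continuousWithinAt
  have hc' : ContinuousOn γ' (Icc 0 1) := fun t ht => (hγ' t ht).2.continuousWithinAt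
  set C := γ '' Icc 0 1 ∪ γ' '' Icc 0 1 with hC
  have hCc : IsCompact C := (isCompact_Icc.image_of_continuousOn hc).union
    (isCompact_Icc.image_of_continuousOn hc')
  have hCU : C ⊆ U := by
    rintro z (⟨t, ht, rfl⟩ | ⟨t, ht, rfl⟩)
    exacts [(hγ t ht).1, (hγ' t ht).1]
  have hL : LocallyLipschitzOn C Z := by
    intro z hz
    obtain ⟨k, t, ht, hk⟩ :=
      (hZ.contDiffAt (hU.mem_nhds (hCU hz))).exists_lipschitzOnWith
    exact ⟨k, t, mem_nhdsWithin_of_mem_nhds ht, hk⟩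
  obtain ⟨k, hk⟩ := hL.exists_lipschitzOnWith_of_compact hCc
  have hder : ∀ {η : ℝ → V}, (∀ t ∈ Icc (0 : ℝ) 1, η t ∈ U ∧
      HasDerivWithinAt η (Z (η t)) (Icc 0 1) t) →
      ∀ t ∈ Ico (0 : ℝ) 1, HasDerivWithinAt η (Z (η t)) (Ici t) t := fun hη t ht =>
    ((hη t (Ico_subset_Icc_self ht)).2.mono (Icc_subset_Icc_left ht.1)).mono_of_mem_nhdsWithin
      (Icc_mem_nhdsGE ht.2)
  exact ODE_solution_unique_of_mem_Icc_right (v := fun _ => Z) (s := fun _ => C) (fun _ _ => hk)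
    hc (hder hγ) (fun t ht => Or.inl ⟨t, Ico_subset_Icc_self ht, rfl⟩) hc' (hder hγ')
    (fun t ht => Or.inr ⟨t, Ico_subset_Icc_self ht, rfl⟩) (h0.trans h0'.symm) (by simp)

end Arc

/-- A control-affine system on an open subset `dom` of a normed space, with smooth drift and smooth
control vector fields `ctrl i`. -/
structure ControlSystem (V ι : Type*) [NormedAddCommGroup V] [NormedSpace ℝ V] where
  dom : Set V
  drift : V → V
  ctrl : ι → V → V
  isOpen_dom : IsOpen dom
  contDiffOn_drift : ContDiffOn ℝ ∞ drift dom
  contDiffOn_ctrl : ∀ i, ContDiffOn ℝ ∞ (ctrl i) dom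

namespace ControlSystem

variable {V ι : Type*} [NormedAddCommGroup V] [NormedSpace ℝ V] (S : ControlSystem V ι)

/-- `S.Chain ε n x y`: the point `y` is reached from `x` along `n` consecutive arcs on `[0, 1]` of
vector fields of the form `ε • drift + θ • ctrl i`. -/
inductive Chain (ε : ℝ) : ℕ → V → V → Prop
  | nil {x : V} (hx : x ∈ S.dom) : Chain ε 0 x x
  | cons {n : ℕ} {x y z : V} (i : ι) (θ : ℝ) (h : Arc S.dom (ε • S.drift + θ • S.ctrl i) x y)
      (h' : Chain ε n y z) : Chain ε (n + 1) x z

variable {S}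

lemma Chain.trans {ε : ℝ} {n m : ℕ} {x y z : V} (h : S.Chain ε n x y) (h' : S.Chain ε m y z) :
    S.Chain ε (n + m) x z := by
  induction h with
  | nil => simpa using h'
  | cons i θ h _ ih => rw [Nat.add_right_comm]; exact .cons i θ h (ih h')

lemma Chain.single {ε : ℝ} {x y : V} (i : ι) (θ : ℝ)
    (h : Arc S.dom (ε • S.drift + θ • S.ctrl i) x y) : S.Chain ε 1 x y :=
  .cons i θ h (.nil h.right_mem)

lemma Chain.right_mem {ε : ℝ} {n : ℕ} {x y : V} (h : S.Chain ε n x y) : y ∈ S.dom := by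
  induction h with
  | nil hx => exact hx
  | cons i θ h _ ih => exact ih

variable (S) in
/-- `S.Orbit x y`: the point `y` is reached from `x` by the driftless system. -/
def Orbit (x y : V) : Prop := ∃ n, S.Chain 0 n x y

lemma Orbit.refl {x : V} (hx : x ∈ S.dom) : S.Orbit x x := ⟨0, .nil hx⟩

lemma Orbit.trans {x y z : V} : S.Orbit x y → S.Orbit y z → S.Orbit x z := by
  rintro ⟨n, h⟩ ⟨m, h'⟩
  exact ⟨n + m, h.trans h'⟩

lemma Orbit.single {x y : V} (i : ι) (θ : ℝ) (h : Arc S.dom (θ • S.ctrl i) x y) : S.Orbit x y :=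
  ⟨1, .single i θ (by simpa using h)⟩

/-- Induction along the arcs of an orbit. -/
lemma Orbit.induction {P : V → V → Prop} (hrefl : ∀ x ∈ S.dom, P x x)
    (hstep : ∀ (x y z : V) (i : ι) (θ : ℝ), Arc S.dom (θ • S.ctrl i) x y → P y z → P x z) {x y : V}
    (h : S.Orbit x y) : P x y := by
  obtain ⟨n, h⟩ := h
  induction h with
  | nil hx => exact hrefl _ hx
  | cons i θ h _ ih => exact hstep _ _ _ i θ (by simpa using h) ih

lemma Orbit.symm {x y : V} (h : S.Orbit x y) : S.Orbit y x := by
  refine Orbit.induction (P := fun x y => S.Orbit y x) (fun x hx => .refl hx) ?_ h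
  intro x y z i θ h h'
  refine h'.trans (.single i (-θ) ?_)
  simpa using h.symm

lemma Orbit.right_mem {x y : V} (h : S.Orbit x y) : y ∈ S.dom := h.choose_spec.right_mem

end ControlSystem

end AffineControl

namespace AffineControl

open Filter Topology Set

/-! ### Maneuvers and the flows of control fields. -/

namespace ControlSystem

variable {V ι : Type*} [NormedAddCommGroup V] [NormedSpace ℝ V] {S : ControlSystem V ι}

variable (S) in
/-- There is a family of chains `x' ⟶ Ψ (x', ε, θ)`, for `x'` near `x`, small drift coefficient `ε`
and parameters `θ` near some `θ₀`, whose end point map is strictly differentiable, sends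
`(x, 0, θ₀)` to `y`, has partial derivative `L` in the initial point, and whose partial derivative
in the parameter has a range that contains `R`. -/
def Maneuver (x y : V) (L : V →L[ℝ] V) (R : Submodule ℝ V) : Prop :=
  ∃ (ℓ : ℕ) (Θ : Type) (_ : NormedAddCommGroup Θ) (_ : NormedSpace ℝ Θ) (_ : CompleteSpace Θ)
    (Ψ : V × ℝ × Θ → V) (Ψ' : V × ℝ × Θ →L[ℝ] V) (θ₀ : Θ), 0 < ℓ ∧
    HasStrictFDerivAt Ψ Ψ' (x, 0, θ₀) ∧ Ψ (x, 0, θ₀) = y ∧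
    (∀ᶠ q in 𝓝 (x, (0 : ℝ), θ₀), S.Chain q.2.1 ℓ q.1 (Ψ q)) ∧
    (∀ v, Ψ' (v, 0, 0) = L v) ∧ ∀ w ∈ R, ∃ η, Ψ' (0, 0, η) = w

lemma Maneuver.mono {x y : V} {L : V →L[ℝ] V} {R R' : Submodule ℝ V} (h : S.Maneuver x y L R)
    (hR : R' ≤ R) : S.Maneuver x y L R' := by
  obtain ⟨ℓ, Θ, i1, i2, i3, Ψ, Ψ', θ₀, h1, h2, h3, h4, h5, h6⟩ := h
  exact ⟨ℓ, Θ, i1, i2, i3, Ψ, Ψ', θ₀, h1, h2, h3, h4, h5, fun w hw => h6 w (hR hw)⟩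

/-- Concatenation with independent parameters and a common `ε`: variations made on the first leg are
transported by `L₂`, those of the second leg are added. -/
lemma Maneuver.comp {x y z : V} {L₁ L₂ : V →L[ℝ] V} {R₁ R₂ : Submodule ℝ V}
    (h₁ : S.Maneuver x y L₁ R₁) (h₂ : S.Maneuver y z L₂ R₂) :
    S.Maneuver x z (L₂ ∘L L₁) (R₁.map (L₂ : V →ₗ[ℝ] V) ⊔ R₂) := by
  obtain ⟨ℓ₁, Θ₁, i1, i2, i3, Ψ₁, Ψ₁', θ₁, h1, h2, rfl, h4, h5, h6⟩ := h₁
  obtain ⟨ℓ₂, Θ₂, j1, j2, j3, Ψ₂, Ψ₂', θ₂, k1, k2, rfl, k4, k5, k6⟩ := h₂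
  let p₁ : V × ℝ × (Θ₁ × Θ₂) →L[ℝ] V × ℝ × Θ₁ :=
    (ContinuousLinearMap.fst ℝ V _).prod
      (((ContinuousLinearMap.fst ℝ ℝ _).comp (ContinuousLinearMap.snd ℝ V _)).prod
        ((ContinuousLinearMap.fst ℝ Θ₁ Θ₂).comp ((ContinuousLinearMap.snd ℝ ℝ _).comp
          (ContinuousLinearMap.snd ℝ V _))))
  let p₂ : V × ℝ × (Θ₁ × Θ₂) →L[ℝ] ℝ × Θ₂ :=
    ((ContinuousLinearMap.fst ℝ ℝ _).comp (ContinuousLinearMap.snd ℝ V _)).prod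
        ((ContinuousLinearMap.snd ℝ Θ₁ Θ₂).comp ((ContinuousLinearMap.snd ℝ ℝ _).comp
          (ContinuousLinearMap.snd ℝ V _)))
  have hp₁ : ∀ q, p₁ q = (q.1, q.2.1, q.2.2.1) := fun q => rfl
  have hp₂ : ∀ q, p₂ q = (q.2.1, q.2.2.2) := fun q => rfl
  let Q : V × ℝ × (Θ₁ × Θ₂) → V × ℝ × Θ₂ := fun q => (Ψ₁ (p₁ q), p₂ q)
  have hΨ₁ : HasStrictFDerivAt (fun q => Ψ₁ (p₁ q)) (Ψ₁' ∘L p₁) (x, 0, (θ₁, θ₂)) :=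
    HasStrictFDerivAt.comp (x, 0, (θ₁, θ₂)) (f := p₁) h2 p₁.hasStrictFDerivAt
  have hQ : HasStrictFDerivAt Q ((Ψ₁' ∘L p₁).prod p₂) (x, 0, (θ₁, θ₂)) :=
    hΨ₁.prodMk p₂.hasStrictFDerivAt
  refine ⟨ℓ₁ + ℓ₂, Θ₁ × Θ₂, inferInstance, inferInstance, inferInstance, Ψ₂ ∘ Q,
    Ψ₂' ∘L ((Ψ₁' ∘L p₁).prod p₂), (θ₁, θ₂), by omega,
    HasStrictFDerivAt.comp (x, (0 : ℝ), (θ₁, θ₂)) (f := Q) k2 hQ, rfl,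
    ?_, ?_, ?_⟩
  · have c1 : Tendsto p₁ (𝓝 (x, 0, (θ₁, θ₂))) (𝓝 (x, 0, θ₁)) := p₁.continuous.tendsto _
    have c2 : Tendsto Q (𝓝 (x, 0, (θ₁, θ₂))) (𝓝 (Ψ₁ (x, 0, θ₁), 0, θ₂)) :=
      hQ.continuousAt
    filter_upwards [c1.eventually h4, c2.eventually k4] with q hq1 hq2
    exact hq1.trans hq2
  · intro v
    have e : ((Ψ₁' ∘L p₁).prod p₂) (v, 0, 0) = (L₁ v, 0, 0) := by
      simp [hp₁, hp₂, h5]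
    rw [ContinuousLinearMap.comp_apply, e, k5, ContinuousLinearMap.comp_apply]
  · intro w hw
    obtain ⟨a, ha, b, hb, rfl⟩ := Submodule.mem_sup.1 hw
    obtain ⟨w₁, hw₁, rfl⟩ := ha
    obtain ⟨η₁, hη₁⟩ := h6 w₁ hw₁
    obtain ⟨η₂, hη₂⟩ := k6 b hb
    refine ⟨(η₁, η₂), ?_⟩
    have e : ((Ψ₁' ∘L p₁).prod p₂) (0, 0, (η₁, η₂)) = (w₁, 0, 0) + (0, 0, η₂) := by
      simp [hp₁, hp₂, hη₁]
    rw [ContinuousLinearMap.comp_apply, e, map_add, k5, hη₂]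
    rfl

/-- Local flow of a control vector field. -/
lemma exists_flow [CompleteSpace V] (i : ι) {x₀ : V} (hx₀ : x₀ ∈ S.dom) :
    ∃ φ : V × ℝ → V, ContDiffAt ℝ 2 φ (x₀, 0) ∧
      (∀ᶠ p in 𝓝 (x₀, (0 : ℝ)), Arc S.dom (p.2 • S.ctrl i) p.1 (φ p)) ∧
      (∀ᶠ p in 𝓝 (x₀, (0 : ℝ)), S.Maneuver p.1 (φ p) (fderiv ℝ φ p ∘L .inl ℝ V ℝ)
        (Submodule.span ℝ {fderiv ℝ φ p (0, 1)})) := by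
  obtain ⟨G, hG, hArc⟩ := exists_localFlow S.isOpen_dom S.contDiffOn_drift (S.contDiffOn_ctrl i) hx₀
  let j : V × ℝ →L[ℝ] V × ℝ × ℝ := (ContinuousLinearMap.fst ℝ V ℝ).prod
    ((0 : V × ℝ →L[ℝ] ℝ).prod (ContinuousLinearMap.snd ℝ V ℝ))
  have hj : ∀ p, j p = (p.1, 0, p.2) := fun p => rfl
  have hjt : Tendsto j (𝓝 (x₀, 0)) (𝓝 (x₀, 0, 0)) := j.continuous.tendsto _
  refine ⟨G ∘ j, ContDiffAt.comp (x₀, (0 : ℝ)) (f := j) hG j.contDiff.contDiffAt, ?_, ?_⟩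
  · filter_upwards [hjt.eventually hArc] with p hp
    simpa [hj] using hp
  · filter_upwards [hjt.eventually hArc.eventually_nhds,
      hjt.eventually (hG.eventually (by simp))] with p hp1 hp2
    have hs : HasStrictFDerivAt G (fderiv ℝ G (j p)) (j p) := hp2.hasStrictFDerivAt two_ne_zero
    have hd : fderiv ℝ (G ∘ j) p = fderiv ℝ G (j p) ∘L j :=
      (HasFDerivAt.comp p (f := j) hs.hasFDerivAt j.hasFDerivAt).fderiv
    rw [hd]
    -- The maneuver uses `G` rather than its restriction to zero drift, since chains are needed for
    -- all small `ε`.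
    refine ⟨1, ℝ, inferInstance, inferInstance, inferInstance, G, fderiv ℝ G (j p), p.2, one_pos,
      hs, rfl, ?_, ?_, ?_⟩
    · filter_upwards [hp1] with q hq using .single i _ hq
    · intro v; simp [hj]
    · intro w hw
      obtain ⟨c, rfl⟩ := Submodule.mem_span_singleton.1 hw
      refine ⟨c, ?_⟩
      rw [ContinuousLinearMap.comp_apply, ← map_smul]
      simp [hj]

lemma ctrl_smooth (i : ι) (θ : ℝ) : ContDiffOn ℝ 1 (θ • S.ctrl i) S.dom :=
  ((S.contDiffOn_ctrl i).of_le (by simp)).const_smul θ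

section Flow

variable [CompleteSpace V] {i : ι} {x₀ : V} {φ : V × ℝ → V}

lemma flow_zero (hφ : ∀ᶠ p in 𝓝 (x₀, (0 : ℝ)), Arc S.dom (p.2 • S.ctrl i) p.1 (φ p)) :
    ∀ᶠ x in 𝓝 x₀, φ (x, 0) = x := by
  have c : Tendsto (fun x : V => (x, (0 : ℝ))) (𝓝 x₀) (𝓝 (x₀, 0)) :=
    (Continuous.prodMk_left (0 : ℝ)).tendsto _
  filter_upwards [c.eventually hφ] with x hx
  have h0 : Arc S.dom ((0 : ℝ) • S.ctrl i) x x := by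
    simpa using arc_zero hx.left_mem
  exact hx.unique S.isOpen_dom (ctrl_smooth i 0) h0

lemma tendsto_flow_neg (hs : ContDiffAt ℝ 2 φ (x₀, 0))
    (hφ : ∀ᶠ p in 𝓝 (x₀, (0 : ℝ)), Arc S.dom (p.2 • S.ctrl i) p.1 (φ p)) :
    Tendsto (fun p : V × ℝ => (φ p, -p.2)) (𝓝 (x₀, 0)) (𝓝 (x₀, 0)) := by
  have : ContinuousAt (fun p : V × ℝ => (φ p, -p.2)) (x₀, 0) :=
    hs.continuousAt.prodMk (by fun_prop)
  have h := this.tendsto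
  simp only [(flow_zero hφ).self_of_nhds, neg_zero] at h
  exact h

lemma flow_inv (hs : ContDiffAt ℝ 2 φ (x₀, 0))
    (hφ : ∀ᶠ p in 𝓝 (x₀, (0 : ℝ)), Arc S.dom (p.2 • S.ctrl i) p.1 (φ p)) :
    ∀ᶠ p in 𝓝 (x₀, (0 : ℝ)), φ (φ p, -p.2) = p.1 := by
  filter_upwards [hφ, (tendsto_flow_neg hs hφ).eventually hφ] with p hp hp'
  have h1 := hp.symm
  rw [← neg_smul] at h1
  exact hp'.unique S.isOpen_dom (ctrl_smooth i _) h1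

/-- The time derivative comes from uniqueness, which identifies an arc of parameter `θ` with `s ↦ φ
(x, s * θ)`; the space derivative comes from `φ (·, 0)` being the identity. -/
lemma fderiv_flow_zero (hs : ContDiffAt ℝ 2 φ (x₀, 0))
    (hφ : ∀ᶠ p in 𝓝 (x₀, (0 : ℝ)), Arc S.dom (p.2 • S.ctrl i) p.1 (φ p)) :
    ∀ᶠ x in 𝓝 x₀, fderiv ℝ φ (x, 0) (0, 1) = S.ctrl i x ∧ ∀ v, fderiv ℝ φ (x, 0) (v, 0) = v := by
  have c : Tendsto (fun x : V => (x, (0 : ℝ))) (𝓝 x₀) (𝓝 (x₀, 0)) :=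
    (Continuous.prodMk_left (0 : ℝ)).tendsto _
  filter_upwards [c.eventually hφ.eventually_nhds, c.eventually (hs.eventually (by simp)),
    (flow_zero hφ).eventually_nhds] with x h1 h2 h3
  have hd : HasFDerivAt φ (fderiv ℝ φ (x, 0)) (x, 0) :=
    (h2.differentiableAt two_ne_zero).hasFDerivAt
  refine ⟨?_, fun v => ?_⟩
  · have ct : Tendsto (fun t : ℝ => (x, t)) (𝓝 0) (𝓝 (x, 0)) :=
      (Continuous.prodMk_right x).tendsto _
    obtain ⟨δ, hδ, hball⟩ := Metric.eventually_nhds_iff.1 (ct.eventually h1)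
    set θ := δ / 2 with hθ
    have hθ0 : 0 < θ := half_pos hδ
    obtain ⟨γ, hγ0, hγ1, hγ⟩ := hball (y := θ) (by
      rw [dist_zero_right, Real.norm_eq_abs, abs_of_pos hθ0]; linarith)
    have hγe : ∀ s ∈ Icc (0 : ℝ) 1, γ s = φ (x, s * θ) := by
      intro s hs'
      have ha := arc_of_hasDerivWithinAt hγ (s := 0) (t := s) (by simp) hs'
      rw [hγ0, sub_zero, smul_smul] at ha
      have hb := hball (y := s * θ) (by
        simp only [dist_zero_right, Real.norm_eq_abs, abs_mul, abs_of_pos hθ0, abs_of_nonneg hs'.1]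
        nlinarith [hs'.1, hs'.2])
      exact ha.unique S.isOpen_dom (ctrl_smooth i _) hb
    have d1 := (hγ 0 (by simp)).2
    have d2 : HasDerivWithinAt (fun s : ℝ => φ (x, s * θ)) (fderiv ℝ φ (x, 0) (0, θ))
        (Icc 0 1) 0 := by
      have hl : HasDerivAt (fun s : ℝ => (x, s * θ)) ((0 : V), θ) 0 :=
        (hasDerivAt_const _ _).prodMk (by simpa using (hasDerivAt_id (0 : ℝ)).mul_const θ)
      have hd' : HasFDerivAt φ (fderiv ℝ φ (x, 0)) ((fun s : ℝ => (x, s * θ)) 0) := by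
        simpa using hd
      exact (hd'.comp_hasDerivAt (0 : ℝ) hl).hasDerivWithinAt
    have d3 := d2.congr hγe (hγe 0 (by simp))
    have hu : UniqueDiffWithinAt ℝ (Icc (0 : ℝ) 1) 0 :=
      uniqueDiffOn_Icc zero_lt_one 0 (by simp)
    have heq := hu.eq_deriv _ d1 d3
    rw [hγ0] at heq
    have e : ((0 : V), θ) = θ • ((0 : V), (1 : ℝ)) := by simp
    rw [e, map_smul] at heq
    exact (smul_right_injective V hθ0.ne' heq).symm
  · have d1 : HasFDerivAt (fun x' : V => φ (x', 0)) (fderiv ℝ φ (x, 0) ∘L .inl ℝ V ℝ) x :=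
      hd.comp x (hasFDerivAt_prodMk_left x (0 : ℝ))
    have d2 : HasFDerivAt (fun x' : V => φ (x', 0)) (.id ℝ V) x :=
      (hasFDerivAt_id x).congr_of_eventuallyEq h3
    exact DFunLike.congr_fun (d1.unique d2) v

lemma fderiv_flow_inv (hs : ContDiffAt ℝ 2 φ (x₀, 0))
    (hφ : ∀ᶠ p in 𝓝 (x₀, (0 : ℝ)), Arc S.dom (p.2 • S.ctrl i) p.1 (φ p)) :
    ∀ᶠ p in 𝓝 (x₀, (0 : ℝ)), (fderiv ℝ φ (φ p, -p.2) ∘L .inl ℝ V ℝ) ∘L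
      (fderiv ℝ φ p ∘L .inl ℝ V ℝ) = .id ℝ V := by
  filter_upwards [(flow_inv hs hφ).eventually_nhds, hs.eventually (by simp),
    (tendsto_flow_neg hs hφ).eventually (hs.eventually (by simp))] with p h1 h2 h3
  have c : Tendsto (fun x : V => (x, p.2)) (𝓝 p.1) (𝓝 p) := (Continuous.prodMk_left p.2).tendsto _
  have h4 : (fun x : V => φ (φ (x, p.2), -p.2)) =ᶠ[𝓝 p.1] id := by
    filter_upwards [c.eventually h1] with x hx using hx
  have d1 : HasFDerivAt (fun x : V => φ (x, p.2)) (fderiv ℝ φ p ∘L .inl ℝ V ℝ) p.1 :=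
    (h2.differentiableAt two_ne_zero).hasFDerivAt.comp p.1 (hasFDerivAt_prodMk_left p.1 p.2)
  have d2 : HasFDerivAt (fun x : V => φ (x, -p.2))
      (fderiv ℝ φ (φ p, -p.2) ∘L .inl ℝ V ℝ) (φ p) :=
    (h3.differentiableAt two_ne_zero).hasFDerivAt.comp (φ p)
      (hasFDerivAt_prodMk_left (φ p) (-p.2))
  have d3 := HasFDerivAt.comp (f := fun x : V => φ (x, p.2)) p.1 d2 d1
  exact d3.unique ((hasFDerivAt_id p.1).congr_of_eventuallyEq h4)

end Flow

end ControlSystem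

end AffineControl

/-! ### Steering directions, brackets and robustness under small drift. -/

namespace AffineControl

open Filter Topology Set

lemma mem_of_hasDerivAt_of_eventually_mem {V : Type*} [NormedAddCommGroup V] [NormedSpace ℝ V]
    {D : Submodule ℝ V} (hD : IsClosed (D : Set V)) {c : ℝ → V} {c' : V}
    (hc : HasDerivAt c c' 0) (hmem : ∀ᶠ t in 𝓝 0, c t ∈ D) : c' ∈ D := by
  have h := hasDerivAt_iff_tendsto_slope.1 hc
  refine hD.mem_of_tendsto h ?_
  filter_upwards [nhdsWithin_le_nhds hmem] with t ht
  exact D.smul_mem _ (D.sub_mem ht hmem.self_of_nhds)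

namespace ControlSystem

variable {V ι : Type*} [NormedAddCommGroup V] [NormedSpace ℝ V] {S : ControlSystem V ι}

lemma maneuver_ctrl [CompleteSpace V] (i : ι) {x : V} (hx : x ∈ S.dom) :
    S.Maneuver x x (.id ℝ V) (Submodule.span ℝ {S.ctrl i x}) := by
  obtain ⟨φ, hs, hφ, hm⟩ := exists_flow i hx
  have h1 := hm.self_of_nhds
  have h2 := (flow_zero hφ).self_of_nhds
  have h3 := (fderiv_flow_zero hs hφ).self_of_nhds
  have h4 : fderiv ℝ φ (x, 0) ∘L .inl ℝ V ℝ = .id ℝ V := by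
    ext v; exact h3.2 v
  rwa [h4, h3.1, h2] at h1

variable (S) in
/-- The directions of `V` in which one can steer at `x` along loops of the driftless system. -/
def directions [CompleteSpace V] [Nonempty ι] {x : V} (hx : x ∈ S.dom) : Submodule ℝ V where
  carrier := {w | S.Maneuver x x (.id ℝ V) (Submodule.span ℝ {w})}
  zero_mem' := (maneuver_ctrl (Classical.arbitrary ι) hx).mono (by simp)
  add_mem' := by
    intro a b ha hb
    refine (ha.comp hb).mono ?_
    rw [Submodule.span_singleton_le_iff_mem]
    refine Submodule.add_mem_sup ?_ (Submodule.mem_span_singleton_self b)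
    exact ⟨a, Submodule.mem_span_singleton_self a, rfl⟩
  smul_mem' := by
    intro c a ha
    refine ha.mono ?_
    rw [Submodule.span_singleton_le_iff_mem]
    exact Submodule.smul_mem _ _ (Submodule.mem_span_singleton_self a)

lemma mem_directions [CompleteSpace V] [Nonempty ι] {x : V} {hx : x ∈ S.dom} {w : V} :
    w ∈ S.directions hx ↔ S.Maneuver x x (.id ℝ V) (Submodule.span ℝ {w}) := Iff.rfl

/-- In finite dimension, concatenating finitely many loops realizes all steering directions at once.
-/
lemma maneuver_directions [FiniteDimensional ℝ V] [CompleteSpace V] [Nonempty ι] {x : V}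
    (hx : x ∈ S.dom) : S.Maneuver x x (.id ℝ V) (S.directions hx) := by
  have key : ∀ R : Submodule ℝ V, R ≤ S.directions hx → S.Maneuver x x (.id ℝ V) R := by
    intro R
    refine Submodule.fg_induction (motive := fun R _ => R ≤ S.directions hx →
      S.Maneuver x x (.id ℝ V) R) ?_ ?_ R (IsNoetherian.noetherian R)
    · intro w hw
      exact hw (Submodule.mem_span_singleton_self w)
    · intro R₁ R₂ _ _ h₁ h₂ h
      refine ((h₁ (le_sup_left.trans h)).comp (h₂ (le_sup_right.trans h))).mono ?_
      refine sup_le_sup (fun w hw => ⟨w, hw, rfl⟩) le_rfl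
  exact key _ le_rfl

/-- If a vector field takes its values in the steering directions, then so do its brackets with the
control fields. -/
theorem lieBracket_mem_directions [FiniteDimensional ℝ V] [CompleteSpace V] [Nonempty ι] (i : ι)
    {W : V → V} (hW : ∀ (z : V) (hz : z ∈ S.dom), W z ∈ S.directions hz) {x : V} (hx : x ∈ S.dom)
    (hWx : DifferentiableAt ℝ W x) :
    VectorField.lieBracket ℝ (S.ctrl i) W x ∈ S.directions hx := by
  obtain ⟨φ, hs, hφ, hm⟩ := exists_flow i hx
  have hz := (flow_zero hφ).self_of_nhds
  have hdz := fderiv_flow_zero hs hφ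
  obtain ⟨hdz1, hdz2⟩ := hdz.self_of_nhds
  have hφd : HasFDerivAt φ (fderiv ℝ φ (x, 0)) (x, 0) :=
    (hs.differentiableAt two_ne_zero).hasFDerivAt
  have hlin : HasDerivAt (fun t : ℝ => (x, t)) ((0 : V), (1 : ℝ)) 0 :=
    (hasDerivAt_const _ _).prodMk (hasDerivAt_id _)
  have hline : HasDerivAt (fun t : ℝ => φ (x, t)) (S.ctrl i x) 0 := by
    have := hφd.comp_hasDerivAt (0 : ℝ) hlin
    rwa [hdz1] at this
  have hdφ : DifferentiableAt ℝ (fderiv ℝ φ) (x, 0) :=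
    (hs.fderiv_right (m := 1) (by norm_num)).differentiableAt one_ne_zero
  set B := fderiv ℝ (fderiv ℝ φ) (x, 0) with hB
  have hBd : HasFDerivAt (fderiv ℝ φ) B (x, 0) := hdφ.hasFDerivAt
  have hX : DifferentiableAt ℝ (S.ctrl i) x :=
    ((S.contDiffOn_ctrl i).contDiffAt (S.isOpen_dom.mem_nhds hx)).differentiableAt (by simp)
  -- the second derivatives of the flow at time zero
  have hinl : HasFDerivAt (fun y : V => fderiv ℝ φ (y, 0)) (B ∘L .inl ℝ V ℝ) x :=
    HasFDerivAt.comp x hBd (hasFDerivAt_prodMk_left x (0 : ℝ))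
  have hB1 : ∀ v w : V, B (v, 0) (w, 0) = 0 := by
    intro v w
    have d1 := hinl.clm_apply (hasFDerivAt_const ((w, 0) : V × ℝ) x)
    have d2 : HasFDerivAt (fun y : V => fderiv ℝ φ (y, 0) (w, 0)) (0 : V →L[ℝ] V) x :=
      (hasFDerivAt_const w x).congr_of_eventuallyEq (hdz.mono fun y hy => hy.2 w)
    simpa using DFunLike.congr_fun (d1.unique d2) v
  have hB2 : ∀ v : V, B (v, 0) (0, 1) = fderiv ℝ (S.ctrl i) x v := by
    intro v
    have d1 := hinl.clm_apply (hasFDerivAt_const ((0, 1) : V × ℝ) x)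
    have d2 : HasFDerivAt (fun y : V => fderiv ℝ φ (y, 0) (0, 1)) (fderiv ℝ (S.ctrl i) x) x :=
      hX.hasFDerivAt.congr_of_eventuallyEq (hdz.mono fun y hy => hy.1)
    simpa using DFunLike.congr_fun (d1.unique d2) v
  have hsymm : IsSymmSndFDerivAt ℝ φ (x, 0) := hs.isSymmSndFDerivAt (by simp)
  -- transport of `W` to `x` along the flow
  let c : ℝ → V := fun t => fderiv ℝ φ (φ (x, t), -t) (W (φ (x, t)), 0)
  have hpath : HasDerivAt (fun t : ℝ => (φ (x, t), -t)) (S.ctrl i x, (-1 : ℝ)) 0 :=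
    hline.prodMk (hasDerivAt_neg 0)
  have hc1 : HasDerivAt (fun t : ℝ => fderiv ℝ φ (φ (x, t), -t)) (B (S.ctrl i x, -1)) 0 := by
    refine HasFDerivAt.comp_hasDerivAt (0 : ℝ) ?_ hpath
    simpa [hz] using hBd
  have hc2 : HasDerivAt (fun t : ℝ => (W (φ (x, t)), (0 : ℝ)))
      (fderiv ℝ W x (S.ctrl i x), (0 : ℝ)) 0 := by
    refine HasDerivAt.prodMk ?_ (hasDerivAt_const _ _)
    refine HasFDerivAt.comp_hasDerivAt (0 : ℝ) ?_ hline
    simpa [hz] using hWx.hasFDerivAt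
  have hc : HasDerivAt c (VectorField.lieBracket ℝ (S.ctrl i) W x) 0 := by
    have h := hc1.clm_apply hc2
    have e : B (S.ctrl i x, -1) (W (φ (x, 0)), 0)
        + fderiv ℝ φ (φ (x, 0), -0) (fderiv ℝ W x (S.ctrl i x), 0)
        = VectorField.lieBracket ℝ (S.ctrl i) W x := by
      -- The bracket's minus sign comes from the reversed time `-t`; symmetry of the second
      -- derivative turns the mixed term into the derivative of the control field along `W x`.
      have e1 : (S.ctrl i x, (-1 : ℝ)) = (S.ctrl i x, 0) - ((0 : V), (1 : ℝ)) := by simp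
      have e2 : B (0, 1) (W x, 0) = B (W x, 0) (0, 1) := hsymm _ _
      rw [hz, neg_zero, hdz2, e1, map_sub, sub_apply, hB1, e2, hB2,
        VectorField.lieBracket_eq]
      beta_reduce
      abel
    rwa [e] at h
  refine mem_of_hasDerivAt_of_eventually_mem (Submodule.closed_of_finiteDimensional _) hc ?_
  have ct : Tendsto (fun t : ℝ => (x, t)) (𝓝 0) (𝓝 (x, 0)) := (Continuous.prodMk_right x).tendsto _
  have hneg := tendsto_flow_neg hs hφ
  filter_upwards [ct.eventually hm, ct.eventually (hneg.eventually hm),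
    ct.eventually (fderiv_flow_inv hs hφ), ct.eventually (flow_inv hs hφ),
    ct.eventually hφ] with t h1 h2 h3 h4 h5
  have h6 := hW (φ (x, t)) h5.right_mem
  rw [mem_directions] at h6 ⊢
  -- Flow for time `t`, make a loop in direction `W`, flow back: the result is a loop at `x` with
  -- identity linear part and direction `c t`.
  have h7 := (h1.comp h6).comp h2
  rw [h4, ContinuousLinearMap.id_comp, h3] at h7
  refine h7.mono ?_
  rw [Submodule.span_singleton_le_iff_mem]
  refine Submodule.mem_sup_left ⟨W (φ (x, t)), ?_, rfl⟩
  exact Submodule.mem_sup_right (Submodule.mem_span_singleton_self _)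

/-- Local flows only cover short arcs. Short maneuvers exist in both senses near each point of the
arc, and connectedness of `[0, 1]` chains them together. -/
lemma maneuver_of_arc [CompleteSpace V] {i : ι} {θ : ℝ} {x y : V}
    (h : Arc S.dom (θ • S.ctrl i) x y) :
    ∃ L : V →L[ℝ] V, Function.Surjective L ∧ S.Maneuver x y L ⊥ := by
  obtain ⟨γ, rfl, rfl, hγ⟩ := h
  refine isPreconnected_Icc.induction₂' (s := Icc (0 : ℝ) 1)
    (fun s t => ∃ L : V →L[ℝ] V, Function.Surjective L ∧ S.Maneuver (γ s) (γ t) L ⊥)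
    ?_ ?_ (by simp) (by simp)
  · intro s hs
    obtain ⟨φ, hsm, hφ, hm⟩ := exists_flow (S := S) i (hγ s hs).1
    -- The inverse-flow identity, applied at `(φ p, -p.2)`, gives a right inverse of the derivative
    -- at `p`.
    have hsurj : ∀ᶠ p in 𝓝 (γ s, (0 : ℝ)),
        Function.Surjective (fderiv ℝ φ p ∘L .inl ℝ V ℝ) := by
      filter_upwards [flow_inv hsm hφ,
        (tendsto_flow_neg hsm hφ).eventually (fderiv_flow_inv hsm hφ)] with p h1 h2
      rw [h1, neg_neg] at h2
      intro v
      exact ⟨_, DFunLike.congr_fun h2 v⟩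
    have hgood : ∀ᶠ p in 𝓝 (γ s, (0 : ℝ)), ∀ z, Arc S.dom (p.2 • S.ctrl i) p.1 z →
        ∃ L : V →L[ℝ] V, Function.Surjective L ∧ S.Maneuver p.1 z L ⊥ := by
      filter_upwards [hsurj, hφ, hm] with p h1 h2 h3 z hz
      rw [hz.unique S.isOpen_dom (ctrl_smooth i _) h2]
      exact ⟨_, h1, h3.mono bot_le⟩
    have hγc : ContinuousWithinAt γ (Icc 0 1) s := (hγ s hs).2.continuousWithinAt
    have c1 : Tendsto (fun t : ℝ => (γ s, (t - s) * θ)) (𝓝[Icc 0 1] s) (𝓝 (γ s, 0)) := by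
      have : Continuous (fun t : ℝ => (γ s, (t - s) * θ)) := by fun_prop
      have h := this.tendsto s
      simp only [sub_self, zero_mul] at h
      exact h.mono_left nhdsWithin_le_nhds
    have c2 : Tendsto (fun t : ℝ => (γ t, (s - t) * θ)) (𝓝[Icc 0 1] s) (𝓝 (γ s, 0)) := by
      refine Tendsto.prodMk_nhds hγc ?_
      have : Continuous (fun t : ℝ => (s - t) * θ) := by fun_prop
      have h := this.tendsto s
      simp only [sub_self, zero_mul] at h
      exact h.mono_left nhdsWithin_le_nhds
    filter_upwards [c1.eventually hgood, c2.eventually hgood, self_mem_nhdsWithin] with t h1 h2 ht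
    have a1 := arc_of_hasDerivWithinAt hγ hs ht
    have a2 := arc_of_hasDerivWithinAt hγ ht hs
    rw [smul_smul] at a1 a2
    exact ⟨h1 _ a1, h2 _ a2⟩
  · rintro r s t - - - ⟨L₁, hL₁, h₁⟩ ⟨L₂, hL₂, h₂⟩
    exact ⟨L₂ ∘L L₁, hL₂.comp hL₁, (h₁.comp h₂).mono bot_le⟩

lemma Orbit.exists_maneuver [CompleteSpace V] [Nonempty ι] {x y : V} (h : S.Orbit x y) :
    ∃ L : V →L[ℝ] V, Function.Surjective L ∧ S.Maneuver x y L ⊥ := by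
  refine Orbit.induction (P := fun x y => ∃ L : V →L[ℝ] V, Function.Surjective L ∧
    S.Maneuver x y L ⊥) ?_ ?_ h
  · intro x hx
    exact ⟨.id ℝ V, Function.surjective_id,
      (maneuver_ctrl (Classical.arbitrary ι) hx).mono bot_le⟩
  · rintro x y z i θ h ⟨L₂, hL₂, h₂⟩
    obtain ⟨L₁, hL₁, h₁⟩ := maneuver_of_arc h
    exact ⟨L₂ ∘L L₁, hL₂.comp hL₁, (h₁.comp h₂).mono bot_le⟩

/-- If all directions are steering directions at `x`, the orbit of `x` is a neighbourhood of
`x`. -/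
theorem eventually_orbit [FiniteDimensional ℝ V] [CompleteSpace V] [Nonempty ι] {x : V}
    (hx : x ∈ S.dom) (h : S.directions hx = ⊤) : ∀ᶠ y in 𝓝 x, S.Orbit x y := by
  have hm := maneuver_directions (S := S) hx
  rw [h] at hm
  obtain ⟨ℓ, Θ, i1, i2, i3, Ψ, Ψ', θ₀, h1, h2, h3, h4, h5, h6⟩ := hm
  let j : Θ →L[ℝ] V × ℝ × Θ := (ContinuousLinearMap.inr ℝ V (ℝ × Θ)).comp (.inr ℝ ℝ Θ)
  have hj : HasStrictFDerivAt (fun θ : Θ => (x, (0 : ℝ), θ)) j θ₀ := by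
    have h7 := j.hasStrictFDerivAt (x := θ₀) |>.const_add ((x, 0, 0) : V × ℝ × Θ)
    refine h7.congr_of_eventuallyEq (Eventually.of_forall fun θ => ?_)
    simp [j]
  have hd : HasStrictFDerivAt (fun θ : Θ => Ψ (x, 0, θ)) (Ψ' ∘L j) θ₀ :=
    HasStrictFDerivAt.comp θ₀ (f := fun θ : Θ => (x, (0 : ℝ), θ)) h2 hj
  have hr : (Ψ' ∘L j).range = ⊤ := by
    rw [LinearMap.range_eq_top]
    intro w
    obtain ⟨η, hη⟩ := h6 w trivial
    exact ⟨η, by simpa [j] using hη⟩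
  have hmap := hd.map_nhds_eq_of_surj hr
  simp only [h3] at hmap
  rw [← hmap, eventually_map]
  filter_upwards [hj.continuousAt.eventually h4] with θ hθ using ⟨ℓ, hθ⟩

/-- If one can steer with the driftless system from `x` to `y` through a point where all directions
are steering directions, then one can do so with any small drift. -/
theorem exists_chain_of_orbit [FiniteDimensional ℝ V] [CompleteSpace V] [Nonempty ι] {x y z : V}
    (hxz : S.Orbit x z) (hzy : S.Orbit z y) (h : S.directions hxz.right_mem = ⊤) :
    ∃ ℓ, 0 < ℓ ∧ ∀ᶠ ε in 𝓝 (0 : ℝ), S.Chain ε ℓ x y := by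
  obtain ⟨L₁, -, m₁⟩ := hxz.exists_maneuver
  obtain ⟨L₂, hL₂, m₂⟩ := hzy.exists_maneuver
  have hm := maneuver_directions (S := S) hxz.right_mem
  rw [h] at hm
  -- All directions are created at `z`, and the surjection `L₂` carries them onto all directions at
  -- `y`.
  have hm' := ((m₁.comp hm).comp m₂).mono (R' := ⊤) (by
    rintro w -
    obtain ⟨v, rfl⟩ := hL₂ w
    exact Submodule.mem_sup_left ⟨v, Submodule.mem_sup_right trivial, rfl⟩)
  obtain ⟨ℓ, Θ, i1, i2, i3, Ψ, Ψ', θ₀, h1, h2, h3, h4, h5, h6⟩ := hm'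
  refine ⟨ℓ, h1, ?_⟩
  let j : ℝ × Θ →L[ℝ] V × ℝ × Θ := ContinuousLinearMap.inr ℝ V (ℝ × Θ)
  have hj : HasStrictFDerivAt (fun p : ℝ × Θ => (x, p)) j (0, θ₀) := by
    have h7 := j.hasStrictFDerivAt (x := (0, θ₀)) |>.const_add ((x, 0) : V × ℝ × Θ)
    refine h7.congr_of_eventuallyEq (Eventually.of_forall fun θ => ?_)
    simp [j]
  -- Recording `ε` next to the end point makes the derivative triangular and onto; local
  -- surjectivity then hits `(ε, y)` for each small `ε`.
  have hd : HasStrictFDerivAt (fun p : ℝ × Θ => (p.1, Ψ (x, p)))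
      ((ContinuousLinearMap.fst ℝ ℝ Θ).prod (Ψ' ∘L j)) (0, θ₀) :=
    hasStrictFDerivAt_fst.prodMk
      (HasStrictFDerivAt.comp (0, θ₀) (f := fun p : ℝ × Θ => (x, p)) h2 hj)
  have hr : ((ContinuousLinearMap.fst ℝ ℝ Θ).prod (Ψ' ∘L j)).range = ⊤ := by
    rw [LinearMap.range_eq_top]
    rintro ⟨e, w⟩
    obtain ⟨η, hη⟩ := h6 (w - Ψ' (0, e, 0)) trivial
    refine ⟨(e, η), ?_⟩
    have e1 : ((0 : V), e, η) = (0, e, 0) + (0, 0, η) := by simp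
    refine Prod.ext rfl ?_
    show Ψ' (0, e, η) = w
    rw [e1, map_add, hη]
    abel
  have hmap := hd.map_nhds_eq_of_surj hr
  simp only [h3] at hmap
  have hev : ∀ᶠ q in 𝓝 ((0 : ℝ), y), S.Chain q.1 ℓ x q.2 := by
    rw [← hmap, eventually_map]
    filter_upwards [hj.continuousAt.eventually h4] with p hp using hp
  have c : Tendsto (fun ε : ℝ => (ε, y)) (𝓝 0) (𝓝 (0, y)) := (Continuous.prodMk_left y).tendsto _
  exact c.eventually hev

end ControlSystem

end AffineControl

namespace StatLin

open Filter Topology Set AffineControl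

/-! ### Matrices as endomorphisms, and the lift of vector fields to frames. -/

section Matrices

variable {n : ℕ}

/-- The algebra isomorphism between continuous endomorphisms of `ℝⁿ` and matrices. -/
noncomputable def mat (n : ℕ) : ((Fin n → ℝ) →L[ℝ] (Fin n → ℝ)) ≃ₐ[ℝ] Matrix (Fin n) (Fin n) ℝ :=
  (Module.End.toContinuousLinearMap (𝕜 := ℝ) (Fin n → ℝ)).symm.trans LinearMap.toMatrixAlgEquiv'

lemma mat_fderiv (f : (Fin n → ℝ) → (Fin n → ℝ)) (m : Fin n → ℝ) :
    mat n (fderiv ℝ f m) = jacobian f m := rfl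

lemma mat_symm_apply (A : Matrix (Fin n) (Fin n) ℝ) (v : Fin n → ℝ) :
    (mat n).symm A v = A.mulVec v := rfl

/-- Transposition of continuous endomorphisms of `ℝⁿ`. -/
noncomputable def tr (n : ℕ) :
    ((Fin n → ℝ) →L[ℝ] (Fin n → ℝ)) →L[ℝ] ((Fin n → ℝ) →L[ℝ] (Fin n → ℝ)) :=
  LinearMap.toContinuousLinearMap
    { toFun := fun A => (mat n).symm (mat n A).transpose
      map_add' := fun A B => by simp
      map_smul' := fun c A => by simp }

lemma mat_tr (A : (Fin n → ℝ) →L[ℝ] (Fin n → ℝ)) : mat n (tr n A) = (mat n A).transpose :=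
  (mat n).apply_symm_apply _

lemma tr_mul (A B : (Fin n → ℝ) →L[ℝ] (Fin n → ℝ)) : tr n (A * B) = tr n B * tr n A := by
  apply (mat n).injective
  simp [mat_tr, Matrix.transpose_mul]

@[simp] lemma tr_tr (A : (Fin n → ℝ) →L[ℝ] (Fin n → ℝ)) : tr n (tr n A) = A := by
  apply (mat n).injective
  simp [mat_tr]

@[simp] lemma tr_one : tr n 1 = 1 := by
  apply (mat n).injective
  simp [mat_tr]

end Matrices

section Lift

variable {E : Type*} [NormedAddCommGroup E] [NormedSpace ℝ E]

/-- The lift of a vector field to the bundle of linear frames: `(m, A) ↦ (W(m), DW(m) A)`. -/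
noncomputable def lift (W : E → E) (p : E × (E →L[ℝ] E)) : E × (E →L[ℝ] E) :=
  (W p.1, (fderiv ℝ W p.1).comp p.2)

lemma contDiffOn_lift {M : Set E} (hM : IsOpen M) {W : E → E} (hW : ContDiffOn ℝ ∞ W M)
    {s : Set (E × (E →L[ℝ] E))} (hs : ∀ p ∈ s, p.1 ∈ M) : ContDiffOn ℝ ∞ (lift W) s := by
  have h1 : ContDiffOn ℝ ∞ (fun p : E × (E →L[ℝ] E) => W p.1) s :=
    hW.comp contDiffOn_fst hs
  have h2 : ContDiffOn ℝ ∞ (fun p : E × (E →L[ℝ] E) => fderiv ℝ W p.1) s :=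
    (hW.fderiv_of_isOpen hM (m := ∞) (by simp)).comp contDiffOn_fst hs
  exact h1.prodMk (h2.clm_comp contDiffOn_snd)

lemma hasFDerivAt_lift {M : Set E} (hM : IsOpen M) {W : E → E} (hW : ContDiffOn ℝ ∞ W M)
    {p : E × (E →L[ℝ] E)} (hp : p.1 ∈ M) : DifferentiableAt ℝ (lift W) p ∧
    ∀ q, fderiv ℝ (lift W) p q = (fderiv ℝ W p.1 q.1,
      (fderiv ℝ (fderiv ℝ W) p.1 q.1).comp p.2 + (fderiv ℝ W p.1).comp q.2) := by
  have hWat : ContDiffAt ℝ ∞ W p.1 := hW.contDiffAt (hM.mem_nhds hp)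
  have hW1 : HasFDerivAt W (fderiv ℝ W p.1) p.1 := (hWat.differentiableAt (by simp)).hasFDerivAt
  have hW2 : HasFDerivAt (fderiv ℝ W) (fderiv ℝ (fderiv ℝ W) p.1) p.1 :=
    ((hWat.fderiv_right (m := 1) (by norm_cast)).differentiableAt one_ne_zero).hasFDerivAt
  have h1 := hW1.comp p hasFDerivAt_fst
  have h2 := (hW2.comp p hasFDerivAt_fst).clm_comp (hasFDerivAt_snd (p := p))
  have h3 := h1.prodMk h2
  refine ⟨h3.differentiableAt, fun q => ?_⟩
  have e : fderiv ℝ (lift W) p = _ := h3.fderiv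
  rw [e]
  simp [add_comm]

lemma contDiffOn_lieBracket {M : Set E} (hM : IsOpen M) {V W : E → E} (hV : ContDiffOn ℝ ∞ V M)
    (hW : ContDiffOn ℝ ∞ W M) : ContDiffOn ℝ ∞ (VectorField.lieBracket ℝ V W) M := by
  rw [VectorField.lieBracket_eq]
  exact ((hW.fderiv_of_isOpen hM (m := ∞) (by simp)).clm_apply hV).sub
    ((hV.fderiv_of_isOpen hM (m := ∞) (by simp)).clm_apply hW)

/-- The lift is the field of the linearized flow acting on frames, hence compatible with brackets.
In the computation, symmetry of second derivatives matches the remaining terms. -/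
lemma lieBracket_lift {M : Set E} (hM : IsOpen M) {V W : E → E} (hV : ContDiffOn ℝ ∞ V M)
    (hW : ContDiffOn ℝ ∞ W M) {p : E × (E →L[ℝ] E)} (hp : p.1 ∈ M) :
    VectorField.lieBracket ℝ (lift V) (lift W) p = lift (VectorField.lieBracket ℝ V W) p := by
  obtain ⟨-, dV⟩ := hasFDerivAt_lift hM hV hp
  obtain ⟨-, dW⟩ := hasFDerivAt_lift hM hW hp
  have hVat : ContDiffAt ℝ ∞ V p.1 := hV.contDiffAt (hM.mem_nhds hp)
  have hWat : ContDiffAt ℝ ∞ W p.1 := hW.contDiffAt (hM.mem_nhds hp)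
  have hV1 : HasFDerivAt V (fderiv ℝ V p.1) p.1 := (hVat.differentiableAt (by simp)).hasFDerivAt
  have hW1 : HasFDerivAt W (fderiv ℝ W p.1) p.1 := (hWat.differentiableAt (by simp)).hasFDerivAt
  have hV2 : HasFDerivAt (fderiv ℝ V) (fderiv ℝ (fderiv ℝ V) p.1) p.1 :=
    ((hVat.fderiv_right (m := 1) (by norm_cast)).differentiableAt one_ne_zero).hasFDerivAt
  have hW2 : HasFDerivAt (fderiv ℝ W) (fderiv ℝ (fderiv ℝ W) p.1) p.1 :=
    ((hWat.fderiv_right (m := 1) (by norm_cast)).differentiableAt one_ne_zero).hasFDerivAt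
  have hVs : IsSymmSndFDerivAt ℝ V p.1 := hVat.isSymmSndFDerivAt (by simp; norm_cast)
  have hWs : IsSymmSndFDerivAt ℝ W p.1 := hWat.isSymmSndFDerivAt (by simp; norm_cast)
  have hB := ((hW2.clm_apply hV1).sub (hV2.clm_apply hW1)).fderiv
  refine Prod.ext ?_ ?_
  · simp only [VectorField.lieBracket, dV, dW, lift, Prod.fst_sub]
  · ext1 v
    simp only [VectorField.lieBracket, dV, dW, lift, Prod.snd_sub]
    rw [show fderiv ℝ (VectorField.lieBracket ℝ V W) p.1 = _ from hB]
    simp only [ContinuousLinearMap.comp_apply, sub_apply, add_apply,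
      ContinuousLinearMap.flip_apply]
    rw [hVs.eq (p.2 v) (W p.1), hWs.eq (p.2 v) (V p.1)]
    abel

end Lift

end StatLin

namespace StatLin

open Filter Topology Set AffineControl

/-- Continuous endomorphisms of `ℝⁿ`. -/
abbrev EndR (n : ℕ) : Type := (Fin n → ℝ) →L[ℝ] (Fin n → ℝ)

/-! ### The lifted control system and its rank. -/

section System

variable {n d k : ℕ}

/-- The infinitesimal right rotation `(m, A) ↦ (0, A (B - Bᵀ))` of the frame bundle. -/
noncomputable def rotation (B : EndR n) (p : (Fin n → ℝ) × EndR n) : (Fin n → ℝ) × EndR n :=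
  (0, p.2.comp (B - tr n B))

/-- A lift of the drift field to the frame bundle:
`(m, A) ↦ (f₀(m), Df₀(m) A + ½ g(m) g(m)ᵀ A⁻ᵀ)`. -/
noncomputable def liftedDrift (f₀ : (Fin n → ℝ) → (Fin n → ℝ))
    (g : (Fin n → ℝ) → Matrix (Fin n) (Fin d) ℝ) (p : (Fin n → ℝ) × EndR n) :
    (Fin n → ℝ) × EndR n :=
  (f₀ p.1, (fderiv ℝ f₀ p.1).comp p.2 +
    (1 / 2 : ℝ) • ((mat n).symm (g p.1 * (g p.1).transpose)).comp (tr n (Ring.inverse p.2)))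

lemma contDiffOn_liftedDrift {M : Set (Fin n → ℝ)} (hM : IsOpen M)
    {f₀ : (Fin n → ℝ) → (Fin n → ℝ)} {g : (Fin n → ℝ) → Matrix (Fin n) (Fin d) ℝ}
    (hf₀ : ContDiffOn ℝ ∞ f₀ M) (hg : ∀ a b, ContDiffOn ℝ ∞ (fun m => g m a b) M) :
    ContDiffOn ℝ ∞ (liftedDrift f₀ g) (M ×ˢ {A : EndR n | IsUnit A}) := by
  have h1 := contDiffOn_lift hM hf₀ (s := M ×ˢ {A : EndR n | IsUnit A}) fun p hp => hp.1
  have h2 : ContDiffOn ℝ ∞ (fun m => (mat n).symm (g m * (g m).transpose)) M := by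
    rw [contDiffOn_clm_apply]
    intro v
    rw [contDiffOn_pi]
    intro a
    simp only [mat_symm_apply, Matrix.mulVec, dotProduct, Matrix.mul_apply, Matrix.transpose_apply]
    exact ContDiffOn.sum fun b _ => (ContDiffOn.sum fun c _ =>
      (hg a c).mul (hg b c)).mul contDiffOn_const
  have h3 : ContDiffOn ℝ ∞ (fun A : EndR n => tr n (Ring.inverse A)) {A | IsUnit A} := by
    refine (tr n).contDiff.comp_contDiffOn fun A hA => ?_
    obtain ⟨a, rfl⟩ := hA
    exact (contDiffAt_ringInverse ℝ a).contDiffWithinAt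
  have h4 : ContDiffOn ℝ ∞ (fun p : (Fin n → ℝ) × EndR n => (1 / 2 : ℝ) •
      ((mat n).symm (g p.1 * (g p.1).transpose)).comp (tr n (Ring.inverse p.2)))
      (M ×ˢ {A : EndR n | IsUnit A}) :=
    ((h2.comp contDiffOn_fst fun p hp => hp.1).clm_comp
      (h3.comp contDiffOn_snd fun p hp => hp.2)).const_smul _
  exact h1.fst.prodMk (h1.snd.add h4)

/-- The lift of the statistical linearization to the frame bundle, with the right rotations as
additional control fields. -/
noncomputable def liftedSystem {M : Set (Fin n → ℝ)} (hM : IsOpen M)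
    {f₀ : (Fin n → ℝ) → (Fin n → ℝ)} {f : Fin k → (Fin n → ℝ) → (Fin n → ℝ)}
    {g : (Fin n → ℝ) → Matrix (Fin n) (Fin d) ℝ}
    (hf₀ : ContDiffOn ℝ ∞ f₀ M) (hf : ∀ i, ContDiffOn ℝ ∞ (f i) M)
    (hg : ∀ a b, ContDiffOn ℝ ∞ (fun m => g m a b) M) :
    ControlSystem ((Fin n → ℝ) × EndR n) (Fin k ⊕ EndR n) where
  dom := M ×ˢ {A : EndR n | IsUnit A}
  drift := liftedDrift f₀ g
  ctrl := Sum.elim (fun i => lift (f i)) rotation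
  isOpen_dom := hM.prod Units.isOpen
  contDiffOn_drift := contDiffOn_liftedDrift hM hf₀ hg
  contDiffOn_ctrl := by
    rintro (i | B)
    · exact contDiffOn_lift hM (hf i) fun p hp => hp.1
    · exact contDiffOn_const.prodMk (contDiffOn_snd.clm_comp contDiffOn_const)

end System

section Rank

variable {n : ℕ}

/-- A subspace of `ℝⁿ × Sym(n)` of full dimension contains all of `ℝⁿ × Sym(n)`. -/
lemma mem_of_finrank_eq {L : Submodule ℝ ((Fin n → ℝ) × Matrix (Fin n) (Fin n) ℝ)}
    (hL : ∀ v ∈ L, v.2.transpose = v.2) (hrank : Module.finrank ℝ L = n + n * (n + 1) / 2)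
    {v : (Fin n → ℝ) × Matrix (Fin n) (Fin n) ℝ} (hv : v.2.transpose = v.2) : v ∈ L := by
  -- Symmetric matrices are functions on unordered pairs of indices, of which there are `n * (n + 1)
  -- / 2`.
  let T : (Fin n → ℝ) × (Sym2 (Fin n) → ℝ) →ₗ[ℝ] (Fin n → ℝ) × Matrix (Fin n) (Fin n) ℝ :=
    LinearMap.prodMap LinearMap.id
      { toFun := fun φ => Matrix.of fun i j => φ s(i, j)
        map_add' := fun _ _ => rfl
        map_smul' := fun _ _ => rfl }
  have hmem : ∀ w : (Fin n → ℝ) × Matrix (Fin n) (Fin n) ℝ, w.2.transpose = w.2 →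
      w ∈ LinearMap.range T := by
    intro w hw
    refine ⟨(w.1, Sym2.lift ⟨fun i j => w.2 i j, fun i j => ?_⟩), Prod.ext rfl ?_⟩
    · exact congrFun (congrFun hw.symm i) j
    · ext i j; rfl
  have hle : L ≤ LinearMap.range T := fun w hw => hmem w (hL w hw)
  have hcard : Module.finrank ℝ (LinearMap.range T) ≤ Module.finrank ℝ L := by
    refine (LinearMap.finrank_range_le T).trans ?_
    rw [hrank, Module.finrank_prod, Module.finrank_fintype_fun_eq_card,
      Module.finrank_fintype_fun_eq_card, Sym2.card, Fintype.card_fin, Nat.choose_two_right,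
      Nat.add_sub_cancel, mul_comm]
  rw [Submodule.eq_of_le_of_finrank_le hle hcard]
  exact hmem v hv

end Rank

/-- The one-jet is additive only on fields differentiable at `m`, so differentiability travels
through the span induction. -/
lemma oneJet_mem_of_mem_lieAlgebraGen {n : ℕ} {S : Set ((Fin n → ℝ) → (Fin n → ℝ))}
    {m : Fin n → ℝ} {D : Submodule ℝ ((Fin n → ℝ) × EndR n)}
    (hD : ∀ W, IteratedBracket S W → DifferentiableAt ℝ W m ∧ (W m, fderiv ℝ W m) ∈ D)
    {W : (Fin n → ℝ) → (Fin n → ℝ)} (hW : W ∈ lieAlgebraGen S) :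
    DifferentiableAt ℝ W m ∧ (W m, fderiv ℝ W m) ∈ D := by
  refine Submodule.span_induction (p := fun W _ => DifferentiableAt ℝ W m ∧
    (W m, fderiv ℝ W m) ∈ D) (fun W hW => hD W hW) ?_ ?_ ?_ hW
  · refine ⟨differentiableAt_const 0, ?_⟩
    have e : ((0 : (Fin n → ℝ) → (Fin n → ℝ)) m, fderiv ℝ (0 : (Fin n → ℝ) → (Fin n → ℝ)) m)
        = 0 := Prod.ext rfl (by simp)
    rw [e]
    exact D.zero_mem
  · rintro V W - - ⟨h1, h2⟩ ⟨h3, h4⟩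
    have e : ((V + W) m, fderiv ℝ (V + W) m) = (V m, fderiv ℝ V m) + (W m, fderiv ℝ W m) :=
      Prod.ext rfl (fderiv_add h1 h3)
    rw [e]
    exact ⟨h1.add h3, D.add_mem h2 h4⟩
  · rintro c W - ⟨h1, h2⟩
    have e : ((c • W) m, fderiv ℝ (c • W) m) = c • (W m, fderiv ℝ W m) :=
      Prod.ext rfl (fderiv_const_smul h1 c)
    rw [e]
    exact ⟨h1.const_smul c, D.smul_mem c h2⟩

section Directions

variable {n d k : ℕ} {M : Set (Fin n → ℝ)} {hM : IsOpen M}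
    {f₀ : (Fin n → ℝ) → (Fin n → ℝ)} {f : Fin k → (Fin n → ℝ) → (Fin n → ℝ)}
    {g : (Fin n → ℝ) → Matrix (Fin n) (Fin d) ℝ}
    {hf₀ : ContDiffOn ℝ ∞ f₀ M} {hf : ∀ i, ContDiffOn ℝ ∞ (f i) M}
    {hg : ∀ a b, ContDiffOn ℝ ∞ (fun m => g m a b) M}

lemma lift_bracket_mem_directions {W : (Fin n → ℝ) → (Fin n → ℝ)}
    (hW : IteratedBracket (Set.range f) W) : ContDiffOn ℝ ∞ W M ∧
    ∀ (z : (Fin n → ℝ) × EndR n) (hz : z ∈ (liftedSystem hM hf₀ hf hg).dom),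
      lift W z ∈ (liftedSystem hM hf₀ hf hg).directions hz := by
  induction hW with
  | of hV =>
    obtain ⟨i, rfl⟩ := hV
    exact ⟨hf i, fun z hz => ControlSystem.maneuver_ctrl (Sum.inl i) hz⟩
  | @bracket V W hV _ ih =>
    obtain ⟨i, rfl⟩ := hV
    refine ⟨contDiffOn_lieBracket hM (hf i) ih.1, fun z hz => ?_⟩
    rw [← lieBracket_lift hM (hf i) ih.1 hz.1]
    exact ControlSystem.lieBracket_mem_directions (S := liftedSystem hM hf₀ hf hg) (Sum.inl i)
      ih.2 hz (hasFDerivAt_lift hM ih.1 hz.1).1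

/-- The rank condition gives a steering direction `(v, A')` with the same symmetric part as the
target `(v, A)`. The difference `A - A'` is skew, hence a rotation direction at the frame `1`. -/
theorem directions_eq_top (hrank : ∀ m ∈ M,
      Module.finrank ℝ (StatLin.lieOneJet (Set.range f) m) = n + n * (n + 1) / 2)
    {m : Fin n → ℝ} (hz : (m, 1) ∈ (liftedSystem hM hf₀ hf hg).dom) :
    (liftedSystem hM hf₀ hf hg).directions hz = ⊤ := by
  set D := (liftedSystem hM hf₀ hf hg).directions hz with hD
  have hm : m ∈ M := hz.1
  have hLie : ∀ W ∈ lieAlgebraGen (Set.range f),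
      DifferentiableAt ℝ W m ∧ (W m, fderiv ℝ W m) ∈ D := by
    refine fun W hW => oneJet_mem_of_mem_lieAlgebraGen (fun W hW => ?_) hW
    obtain ⟨h1, h2⟩ := lift_bracket_mem_directions (hM := hM) (hf₀ := hf₀) (hf := hf) (hg := hg) hW
    exact ⟨(h1.contDiffAt (hM.mem_nhds hm)).differentiableAt (by simp), h2 _ hz⟩
  have hsym : ∀ v ∈ lieOneJet (Set.range f) m, v.2.transpose = v.2 := by
    intro v hv
    refine Submodule.span_induction (p := fun v _ => v.2.transpose = v.2) ?_ ?_ ?_ ?_ hv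
    · rintro v ⟨W, -, rfl⟩
      simp [add_comm]
    · simp
    · intro v w _ _ h1 h2; simp [h1, h2]
    · intro c v _ h; simp [h]
  let q : (Fin n → ℝ) × EndR n →ₗ[ℝ] (Fin n → ℝ) × Matrix (Fin n) (Fin n) ℝ :=
    { toFun := fun p => (p.1, mat n p.2 + (mat n p.2).transpose)
      map_add' := fun p r => by
        refine Prod.ext rfl ?_
        simp only [Prod.snd_add, map_add, Matrix.transpose_add]
        abel
      map_smul' := fun c p => by
        refine Prod.ext rfl ?_
        simp }
  have hjet : lieOneJet (Set.range f) m ≤ D.map q := by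
    refine Submodule.span_le.2 ?_
    rintro v ⟨W, hW, rfl⟩
    exact ⟨_, (hLie W hW).2, by simp [q, mat_fderiv]⟩
  rw [eq_top_iff]
  rintro ⟨v, A⟩ -
  obtain ⟨⟨v', A'⟩, hA', he⟩ := hjet (mem_of_finrank_eq hsym (hrank m hm)
    (v := q (v, A)) (by simp [q, add_comm]))
  obtain ⟨he1, he2⟩ := Prod.ext_iff.1 he
  obtain rfl : v' = v := he1
  have he2 : mat n A' + (mat n A').transpose = mat n A + (mat n A).transpose := he2
  have he3 : A' + tr n A' = A + tr n A := by
    apply (mat n).injective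
    simpa [mat_tr] using he2
  have hrot : rotation ((1 / 2 : ℝ) • (A - A')) (m, 1) ∈ D :=
    ControlSystem.maneuver_ctrl (S := liftedSystem hM hf₀ hf hg) (Sum.inr _) hz
  have hsum : (v', A) = (v', A') + rotation ((1 / 2 : ℝ) • (A - A')) (m, 1) := by
    refine Prod.ext (by simp [rotation]) ?_
    have e : tr n A' = A + tr n A - A' := by rw [← he3]; abel
    show A = A' + (1 : EndR n) * (_ - tr n ((1 / 2 : ℝ) • (A - A')))
    rw [one_mul, map_smul, map_sub, e]
    module
  rw [hsum]
  exact D.add_mem hA' hrot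

end Directions

end StatLin

namespace StatLin

open Filter Topology Set AffineControl

/-! ### Global orbits of frames up to rotation. -/

section Orthogonal

variable {n : ℕ}

/-- Orthogonal endomorphisms of `ℝⁿ`. -/
def IsOrth (R : EndR n) : Prop := R * tr n R = 1 ∧ tr n R * R = 1

lemma isOrth_of_mul_tr {R : EndR n} (h : R * tr n R = 1) : IsOrth R := by
  refine ⟨h, (mat n).injective ?_⟩
  have h' : mat n R * mat n (tr n R) = 1 := by rw [← map_mul, h, map_one]
  rw [map_mul, map_one]
  exact mul_eq_one_comm.1 h'

lemma IsOrth.one : IsOrth (1 : EndR n) := by simp [IsOrth]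

lemma IsOrth.tr {R : EndR n} (h : IsOrth R) : IsOrth (tr n R) := by
  simpa [IsOrth] using ⟨h.2, h.1⟩

lemma IsOrth.mul {R S : EndR n} (hR : IsOrth R) (hS : IsOrth S) : IsOrth (R * S) := by
  apply isOrth_of_mul_tr
  rw [tr_mul, mul_assoc, ← mul_assoc S, hS.1, one_mul, hR.1]

lemma IsOrth.isUnit {R : EndR n} (h : IsOrth R) : IsUnit R := ⟨⟨R, _, h.1, h.2⟩, rfl⟩

/-- Orthogonal maps are not isometries for the sup norm on `ℝⁿ`, but their entries are at most `1`
in absolute value. Only uniformity in `R` is needed. -/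
lemma IsOrth.norm_le {R : EndR n} (h : IsOrth R) : ‖R‖ ≤ n := by
  have hm : mat n R * (mat n R).transpose = 1 := by
    rw [← mat_tr, ← map_mul, h.1, map_one]
  have hentry : ∀ a b, |mat n R a b| ≤ 1 := by
    intro a b
    have h1 := congrFun (congrFun hm a) a
    rw [Matrix.mul_apply, Matrix.one_apply_eq] at h1
    have h2 : mat n R a b * mat n R a b ≤ ∑ j, mat n R a j * (mat n R).transpose j a :=
      Finset.single_le_sum (f := fun j => mat n R a j * (mat n R).transpose j a)
        (fun j _ => mul_self_nonneg _) (Finset.mem_univ b)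
    rw [h1] at h2
    exact abs_le_one_iff_mul_self_le_one.2 h2
  refine R.opNorm_le_bound (by positivity) fun v => ?_
  rw [pi_norm_le_iff_of_nonneg (by positivity)]
  intro a
  have e : R v a = ∑ b, mat n R a b * v b := by
    have h3 := congrFun (mat_symm_apply (mat n R) v) a
    rwa [AlgEquiv.symm_apply_apply] at h3
  rw [e]
  calc ‖∑ b, mat n R a b * v b‖ ≤ ∑ b : Fin n, ‖v‖ := by
        refine norm_sum_le_of_le _ fun b _ => ?_
        rw [norm_mul, ← one_mul ‖v‖]
        exact mul_le_mul (hentry a b) (norm_le_pi_norm v b) (norm_nonneg _) zero_le_one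
    _ = n * ‖v‖ := by simp

end Orthogonal

section Frames

variable {n d k : ℕ} {M : Set (Fin n → ℝ)} {hM : IsOpen M}
    {f₀ : (Fin n → ℝ) → (Fin n → ℝ)} {f : Fin k → (Fin n → ℝ) → (Fin n → ℝ)}
    {g : (Fin n → ℝ) → Matrix (Fin n) (Fin d) ℝ}
    {hf₀ : ContDiffOn ℝ ∞ f₀ M} {hf : ∀ i, ContDiffOn ℝ ∞ (f i) M}
    {hg : ∀ a b, ContDiffOn ℝ ∞ (fun m => g m a b) M}

/-- The frames `x` and `y` lie on the same orbit up to a rotation, and so do the frames obtained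
from them by any linear change of frame. -/
def FrameRel (S : ControlSystem ((Fin n → ℝ) × EndR n) (Fin k ⊕ EndR n))
    (x y : (Fin n → ℝ) × EndR n) : Prop :=
  ∃ R, IsOrth R ∧ ∀ c : EndR n, IsUnit c → S.Orbit (x.1, x.2 * c) (y.1, y.2 * (R * c))

lemma FrameRel.trans {S : ControlSystem ((Fin n → ℝ) × EndR n) (Fin k ⊕ EndR n)}
    {x y z : (Fin n → ℝ) × EndR n} (h : FrameRel S x y) (h' : FrameRel S y z) :
    FrameRel S x z := by
  obtain ⟨R, hR, h⟩ := h
  obtain ⟨R', hR', h'⟩ := h'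
  refine ⟨R' * R, hR'.mul hR, fun c hc => (h c hc).trans ?_⟩
  rw [mul_assoc R']
  exact h' _ (hR.isUnit.mul hc)

lemma FrameRel.symm {S : ControlSystem ((Fin n → ℝ) × EndR n) (Fin k ⊕ EndR n)}
    {x y : (Fin n → ℝ) × EndR n} (h : FrameRel S x y) : FrameRel S y x := by
  obtain ⟨R, hR, h⟩ := h
  refine ⟨tr n R, hR.tr, fun c hc => ?_⟩
  have h1 := (h (tr n R * c) (hR.tr.isUnit.mul hc)).symm
  rwa [← mul_assoc R, hR.1, one_mul] at h1

lemma FrameRel.of_mul_orth {S : ControlSystem ((Fin n → ℝ) × EndR n) (Fin k ⊕ EndR n)}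
    {x : (Fin n → ℝ) × EndR n} {m : Fin n → ℝ} {A Q : EndR n} (hQ : IsOrth Q)
    (h : FrameRel S x (m, A * Q)) : FrameRel S x (m, A) := by
  obtain ⟨R, hR, h⟩ := h
  refine ⟨Q * R, hQ.mul hR, fun c hc => ?_⟩
  have h1 := h c hc
  simp only [mul_assoc] at h1 ⊢
  exact h1

/-- Lifted fields commute with right multiplication, so their arcs translate with `R = 1`. Rotation
arcs fix the base point and `A Aᵀ`, so their end frames differ by an orthogonal factor. -/
lemma frameRel_of_arc {x y : (Fin n → ℝ) × EndR n} (j : Fin k ⊕ EndR n) (θ : ℝ)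
    (h : Arc (liftedSystem hM hf₀ hf hg).dom (θ • (liftedSystem hM hf₀ hf hg).ctrl j) x y) :
    FrameRel (liftedSystem hM hf₀ hf hg) x y := by
  obtain ⟨γ, rfl, rfl, hγ⟩ := h
  rcases j with i | B
  · refine ⟨1, .one, fun c hc => .single (Sum.inl i) θ
      ⟨fun t => ((γ t).1, (γ t).2 * c), rfl, by simp, fun t ht => ?_⟩⟩
    obtain ⟨h1, h2⟩ := hγ t ht
    refine ⟨⟨h1.1, h1.2.mul hc⟩, ?_⟩
    let T : (Fin n → ℝ) × EndR n →L[ℝ] (Fin n → ℝ) × EndR n :=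
      (ContinuousLinearMap.id ℝ _).prodMap ((ContinuousLinearMap.mul ℝ (EndR n)).flip c)
    have h3 := T.hasFDerivAt.comp_hasDerivWithinAt t h2
    have e : T ((θ • (liftedSystem hM hf₀ hf hg).ctrl (Sum.inl i)) (γ t)) =
        (θ • (liftedSystem hM hf₀ hf hg).ctrl (Sum.inl i)) ((γ t).1, (γ t).2 * c) := by
      refine Prod.ext rfl ?_
      exact smul_mul_assoc θ ((fderiv ℝ (f i) (γ t).1) * (γ t).2) c
    rwa [e] at h3
  · have hf1 : ∀ t ∈ Icc (0 : ℝ) 1, HasDerivWithinAt (fun t => (γ t).1) 0 (Icc 0 1) t := by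
      intro t ht
      have := (ContinuousLinearMap.fst ℝ (Fin n → ℝ) (EndR n)).hasFDerivAt.comp_hasDerivWithinAt t
        (hγ t ht).2
      simpa [liftedSystem, rotation, Function.comp_def] using this
    have hf2 : ∀ t ∈ Icc (0 : ℝ) 1, HasDerivWithinAt (fun t => (γ t).2)
        (θ • ((γ t).2 * (B - tr n B))) (Icc 0 1) t := by
      intro t ht
      exact (ContinuousLinearMap.snd ℝ (Fin n → ℝ) (EndR n)).hasFDerivAt.comp_hasDerivWithinAt t
        (hγ t ht).2
    have hf3 : ∀ t ∈ Icc (0 : ℝ) 1, HasDerivWithinAt (fun t => (γ t).2 * tr n (γ t).2)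
        0 (Icc 0 1) t := by
      intro t ht
      have h1 := (hf2 t ht).mul ((tr n).hasFDerivAt.comp_hasDerivWithinAt t (hf2 t ht))
      have e : θ • ((γ t).2 * (B - tr n B)) * tr n (γ t).2 +
          (γ t).2 * tr n (θ • ((γ t).2 * (B - tr n B))) = 0 := by
        rw [map_smul, tr_mul, map_sub, tr_tr]
        simp only [smul_mul_assoc, mul_smul_comm, ← smul_add]
        rw [mul_assoc, ← mul_add, ← add_mul]
        simp
      rw [← e]
      exact h1
    have hconst : ∀ {W : Type} [NormedAddCommGroup W] [NormedSpace ℝ W] {η : ℝ → W},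
        (∀ t ∈ Icc (0 : ℝ) 1, HasDerivWithinAt η 0 (Icc 0 1) t) → η 1 = η 0 := by
      intro W _ _ η hη
      exact constant_of_has_deriv_right_zero (fun t ht => (hη t ht).continuousWithinAt)
        (fun t ht => ((hη t (Ico_subset_Icc_self ht)).mono
          (Icc_subset_Icc_left ht.1)).mono_of_mem_nhdsWithin (Icc_mem_nhdsGE ht.2)) 1 (by simp)
    have e1 := hconst hf1
    have e2 := hconst hf3
    obtain ⟨b, hb⟩ : IsUnit (γ 1).2 := (hγ 1 (by simp)).1.2
    have e3 : (γ 1).2 * ((↑b⁻¹ : EndR n) * (γ 0).2) = (γ 0).2 := by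
      rw [← hb, ← mul_assoc, Units.mul_inv, one_mul]
    -- With `R = (γ 1).2⁻¹ (γ 0).2` the two frames to be joined coincide, and the trivial orbit
    -- suffices.
    refine ⟨(↑b⁻¹ : EndR n) * (γ 0).2, isOrth_of_mul_tr ?_, fun c hc => ?_⟩
    · rw [tr_mul, mul_assoc, ← mul_assoc (γ 0).2, ← e2, ← hb, mul_assoc, ← tr_mul,
        Units.inv_mul, tr_one, mul_one, Units.inv_mul]
    · rw [← mul_assoc _ _ c, e3, e1]
      exact .refl ⟨(hγ 0 (by simp)).1.1, ((hγ 0 (by simp)).1.2).mul hc⟩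

lemma frameRel_refl {x : (Fin n → ℝ) × EndR n} (hx : x ∈ (liftedSystem hM hf₀ hf hg).dom) :
    FrameRel (liftedSystem hM hf₀ hf hg) x x :=
  ⟨1, .one, fun c hc => by
    rw [one_mul]
    exact .refl ⟨hx.1, hx.2.mul hc⟩⟩

lemma frameRel_of_orbit {x y : (Fin n → ℝ) × EndR n}
    (h : (liftedSystem hM hf₀ hf hg).Orbit x y) : FrameRel (liftedSystem hM hf₀ hf hg) x y :=
  ControlSystem.Orbit.induction (P := FrameRel (liftedSystem hM hf₀ hf hg))
    (fun _ hx => frameRel_refl hx) (fun _ _ _ j θ h h' => (frameRel_of_arc j θ h).trans h') h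

/-- Reach `Rᵀ u R` from `1`, then translate the orbit from `1` to `C R` by it: this ends at `C u R`,
and `R` is discarded. Conjugation by `R` costs at most `n * n` in norm, so `δ` does not depend on
`C`. -/
lemma exists_frameRel_mul {m : Fin n → ℝ}
    (hN : ∀ᶠ y in 𝓝 (m, (1 : EndR n)), (liftedSystem hM hf₀ hf hg).Orbit (m, 1) y) :
    ∃ δ > 0, ∀ C u : EndR n, FrameRel (liftedSystem hM hf₀ hf hg) (m, 1) (m, C) → ‖u - 1‖ < δ →
      FrameRel (liftedSystem hM hf₀ hf hg) (m, 1) (m, C * u) := by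
  have c : Tendsto (fun u : EndR n => (m, u)) (𝓝 1) (𝓝 (m, 1)) :=
    (Continuous.prodMk_right m).tendsto _
  obtain ⟨δ, hδ, h⟩ := Metric.eventually_nhds_iff.1 (c.eventually hN)
  refine ⟨δ / (n * n + 1), by positivity, ?_⟩
  rintro C u ⟨R, hR, hC⟩ hu
  have e : tr n R * u * R - 1 = tr n R * (u - 1) * R := by
    rw [mul_sub, sub_mul, mul_one, hR.2]
  have hnorm : ‖tr n R * u * R - 1‖ < δ := by
    rw [e]
    calc ‖tr n R * (u - 1) * R‖ ≤ ‖tr n R‖ * ‖u - 1‖ * ‖R‖ := by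
          refine (norm_mul_le _ _).trans ?_
          gcongr
          exact norm_mul_le _ _
      _ ≤ n * ‖u - 1‖ * n := by
          gcongr
          exacts [hR.tr.norm_le, hR.norm_le]
      _ = n * n * ‖u - 1‖ := by ring
      _ ≤ (n * n + 1) * ‖u - 1‖ := by gcongr; linarith
      _ < δ := by rwa [lt_div_iff₀' (by positivity)] at hu
  have h1 : (liftedSystem hM hf₀ hf hg).Orbit (m, 1) (m, tr n R * u * R) :=
    h (by rwa [dist_eq_norm])
  have h2 := h1.trans (by simpa using hC _ h1.right_mem.2)
  refine FrameRel.of_mul_orth hR ?_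
  have e2 : C * (R * (tr n R * u * R)) = C * u * R := by
    rw [← mul_assoc R, ← mul_assoc R, hR.1, one_mul, mul_assoc]
  rw [e2] at h2
  exact frameRel_of_orbit h2

lemma isUnit_of_posDef {C : EndR n} (hC : (mat n C).PosDef) : IsUnit C := by
  have := hC.isUnit.map (mat n).symm
  rwa [AlgEquiv.symm_apply_apply] at this

/-- Since `δ` is uniform, multiplicative steps `C' = C (C⁻¹ C')` propagate the relation through the
convex, hence connected, cone of positive definite matrices. -/
lemma frameRel_of_posDef {m : Fin n → ℝ} (hm : m ∈ M)
    (hN : ∀ᶠ y in 𝓝 (m, (1 : EndR n)), (liftedSystem hM hf₀ hf hg).Orbit (m, 1) y)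
    {C : EndR n} (hC : (mat n C).PosDef) :
    FrameRel (liftedSystem hM hf₀ hf hg) (m, 1) (m, C) := by
  obtain ⟨δ, hδ, h⟩ := exists_frameRel_mul hN
  have hconv : Convex ℝ {C : EndR n | (mat n C).PosDef} := by
    rw [convex_iff_forall_pos]
    intro A hA B hB a b ha hb _
    show (mat n (a • A + b • B)).PosDef
    rw [map_add, map_smul, map_smul]
    exact (hA.smul ha).add (hB.smul hb)
  have h1 : (1 : EndR n) ∈ {C : EndR n | (mat n C).PosDef} := by
    show (mat n 1).PosDef
    rw [map_one]
    exact Matrix.PosDef.one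
  refine hconv.isPreconnected.induction₂' (fun C C' : EndR n =>
    FrameRel (liftedSystem hM hf₀ hf hg) (m, 1) (m, C) →
      FrameRel (liftedSystem hM hf₀ hf hg) (m, 1) (m, C')) ?_ ?_ h1 hC
    (frameRel_refl ⟨hm, isUnit_one⟩)
  · intro C hC
    have hu : IsUnit C := isUnit_of_posDef hC
    have c1 : ContinuousAt (fun C' : EndR n => Ring.inverse C * C') C := by fun_prop
    have c2 : ContinuousAt (fun C' : EndR n => Ring.inverse C' * C) C := by
      obtain ⟨a, rfl⟩ := hu
      exact (NormedRing.inverse_continuousAt a).mul continuousAt_const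
    have hone : Ring.inverse C * C = 1 := Ring.inverse_mul_cancel C hu
    have b1 := c1.eventually (Metric.ball_mem_nhds _ hδ)
    have b2 := c2.eventually (Metric.ball_mem_nhds _ hδ)
    simp only [hone, dist_eq_norm] at b1 b2
    filter_upwards [nhdsWithin_le_nhds b1, nhdsWithin_le_nhds b2, self_mem_nhdsWithin]
      with C' h2 h3 hC'
    have hu' : IsUnit C' := isUnit_of_posDef hC'
    refine ⟨fun hr => ?_, fun hr => ?_⟩
    · have := h C _ hr h2
      rwa [← mul_assoc, Ring.mul_inverse_cancel C hu, one_mul] at this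
    · have := h C' _ hr h3
      rwa [← mul_assoc, Ring.mul_inverse_cancel C' hu', one_mul] at this
  · intro A B C _ _ _ h1 h2 h3
    exact h2 (h1 h3)

-- Move the base point with frame `1`, then the frame to the square root of `P`. The leftover
-- orthogonal factor disappears in `B Bᵀ`.
open scoped MatrixOrder in
theorem exists_orbit_of_posDef (hM_conn : IsPreconnected M)
    (hN : ∀ m ∈ M, ∀ᶠ y in 𝓝 (m, (1 : EndR n)), (liftedSystem hM hf₀ hf hg).Orbit (m, 1) y)
    {m m' : Fin n → ℝ} (hm : m ∈ M) (hm' : m' ∈ M) {P : Matrix (Fin n) (Fin n) ℝ}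
    (hP : P.PosDef) : ∃ B : EndR n, mat n B * (mat n B).transpose = P ∧
      (liftedSystem hM hf₀ hf hg).Orbit (m, 1) (m', B) := by
  have h1 : FrameRel (liftedSystem hM hf₀ hf hg) (m, 1) (m', 1) := by
    refine hM_conn.induction₂ (fun m m' => FrameRel (liftedSystem hM hf₀ hf hg) (m, 1) (m', 1))
      ?_ (fun _ _ _ _ _ _ h h' => h.trans h') (fun _ _ _ _ h => h.symm) hm hm'
    intro m hm
    have c : Tendsto (fun z : Fin n → ℝ => (z, (1 : EndR n))) (𝓝 m) (𝓝 (m, 1)) :=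
      (Continuous.prodMk_left (1 : EndR n)).tendsto _
    filter_upwards [nhdsWithin_le_nhds (c.eventually (hN m hm))] with z hz
    exact frameRel_of_orbit hz
  set C : EndR n := (mat n).symm (CFC.sqrt P) with hC
  have hmC : mat n C = CFC.sqrt P := (mat n).apply_symm_apply _
  have hsq : CFC.sqrt P * CFC.sqrt P = P := CFC.sqrt_mul_sqrt_self P hP.posSemidef.nonneg
  have hpsd : (CFC.sqrt P).PosSemidef := Matrix.nonneg_iff_posSemidef.1 (CFC.sqrt_nonneg P)
  have hpd : (CFC.sqrt P).PosDef := by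
    rw [hpsd.posDef_iff_isUnit]
    refine isUnit_of_mul_isUnit_left (y := CFC.sqrt P) ?_
    rw [hsq]
    exact hP.isUnit
  have hsymm : (CFC.sqrt P).transpose = CFC.sqrt P := by
    simpa using hpsd.isHermitian.eq
  obtain ⟨R, hR, h2⟩ := h1.trans (frameRel_of_posDef hm' (hN m' hm') (C := C) (by rwa [hmC]))
  refine ⟨C * R, ?_, by simpa using h2 1 isUnit_one⟩
  rw [← mat_tr, ← map_mul, tr_mul, mul_assoc, ← mul_assoc R, hR.1, one_mul, map_mul, mat_tr, hmC,
    hsymm, hsq]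

end Frames

end StatLin

namespace StatLin

open Filter Topology Set AffineControl

attribute [local instance] Matrix.normedAddCommGroup Matrix.normedSpace

/-! ### Reachable sets and projection from frames to states. -/

section Reachable

variable {n k : ℕ} {Ω : Set ((Fin n → ℝ) × Matrix (Fin n) (Fin n) ℝ)}
  {F : (Fin n → ℝ) × Matrix (Fin n) (Fin n) ℝ → (Fin k → ℝ) →
      (Fin n → ℝ) × Matrix (Fin n) (Fin n) ℝ}

lemma mem_reachableSet_zero {x : (Fin n → ℝ) × Matrix (Fin n) (Fin n) ℝ} (hx : x ∈ Ω) :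
    x ∈ reachableSet Ω F x 0 :=
  ⟨fun _ => 0, fun _ => x, ⟨continuousOn_const, fun _ _ => hx, ∅, fun t ht => by
    simp at ht⟩, rfl, rfl⟩

lemma reachableSet_trans {x y z : (Fin n → ℝ) × Matrix (Fin n) (Fin n) ℝ} {T₁ T₂ : ℝ}
    (hT₁ : 0 ≤ T₁) (hT₂ : 0 ≤ T₂) (h₁ : y ∈ reachableSet Ω F x T₁)
    (h₂ : z ∈ reachableSet Ω F y T₂) : z ∈ reachableSet Ω F x (T₁ + T₂) := by
  obtain ⟨u₁, X₁, ⟨hc₁, hm₁, s₁, hs₁⟩, rfl, rfl⟩ := h₁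
  obtain ⟨u₂, X₂, ⟨hc₂, hm₂, s₂, hs₂⟩, h0, rfl⟩ := h₂
  set X : ℝ → (Fin n → ℝ) × Matrix (Fin n) (Fin n) ℝ :=
    fun t => if t ≤ T₁ then X₁ t else X₂ (t - T₁) with hX
  have hX₁ : ∀ t ≤ T₁, X t = X₁ t := fun t ht => if_pos ht
  have hX₂ : ∀ t ≥ T₁, X t = X₂ (t - T₁) := by
    intro t ht
    rcases eq_or_lt_of_le ht with rfl | ht
    · rw [hX₁ _ le_rfl, sub_self, h0]
    · exact if_neg (not_le.2 ht)
  have hmaps : MapsTo (fun t => t - T₁) (Icc T₁ (T₁ + T₂)) (Icc 0 T₂) := fun t ht =>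
    ⟨by simpa using ht.1, by simpa [add_comm] using ht.2⟩
  refine ⟨fun t => if t ≤ T₁ then u₁ t else u₂ (t - T₁), X, ⟨?_, ?_, ?_⟩, hX₁ _ hT₁, ?_⟩
  · rw [← Icc_union_Icc_eq_Icc (b := T₁) hT₁ (by linarith)]
    refine ContinuousOn.union_of_isClosed (hc₁.congr fun t ht => hX₁ t ht.2) ?_ isClosed_Icc
      isClosed_Icc
    exact (hc₂.comp (by fun_prop) hmaps).congr fun t ht => hX₂ t ht.1
  · intro t ht
    rcases le_total t T₁ with h | h
    · rw [hX₁ t h]; exact hm₁ t ⟨ht.1, h⟩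
    · rw [hX₂ t h]; exact hm₂ _ (hmaps ⟨h, ht.2⟩)
  · refine ⟨s₁ ∪ s₂.image (fun t => t + T₁) ∪ {T₁}, fun t ht hts => ?_⟩
    simp only [Finset.mem_union, Finset.mem_image, Finset.mem_singleton, not_or, not_exists,
      not_and] at hts
    obtain ⟨⟨ht1, ht2⟩, ht3⟩ := hts
    rcases lt_or_gt_of_ne ht3 with h | h
    · obtain ⟨a, b⟩ := hs₁ t ⟨ht.1, h⟩ ht1
      have hev : ∀ᶠ r in 𝓝 t, r < T₁ := Iio_mem_nhds h
      simp only [if_pos h.le, hX₁ t h.le]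
      refine ⟨?_, b.congr_of_eventuallyEq ?_⟩
      · filter_upwards [hev, a] with r hr har
        rw [if_pos hr.le, har]
      · filter_upwards [hev] with r hr using hX₁ r hr.le
    · obtain ⟨a, b⟩ := hs₂ (t - T₁) ⟨by linarith, by linarith [ht.2]⟩ fun hmem =>
        ht2 _ hmem (by ring)
      have hev : ∀ᶠ r in 𝓝 t, T₁ < r := Ioi_mem_nhds h
      simp only [if_neg (not_le.2 h), hX₂ t h.le]
      refine ⟨?_, (b.comp_sub_const t T₁).congr_of_eventuallyEq ?_⟩
      · have c : Tendsto (fun r => r - T₁) (𝓝 t) (𝓝 (t - T₁)) :=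
          (continuous_id.sub continuous_const).tendsto t
        filter_upwards [hev, c.eventually a] with r hr har
        rw [if_neg (not_le.2 hr), har]
      · filter_upwards [hev] with r hr using hX₂ r hr.le
  · rw [hX₂ _ (by linarith)]
    simp

lemma reachableSet_subset {x : (Fin n → ℝ) × Matrix (Fin n) (Fin n) ℝ} {T : ℝ} (hT : 0 ≤ T) :
    reachableSet Ω F x T ⊆ Ω := by
  rintro _ ⟨u, X, h, -, rfl⟩
  exact h.mem T ⟨hT, le_rfl⟩

end Reachable

section Projection

variable {n d k : ℕ} {M : Set (Fin n → ℝ)} {hM : IsOpen M}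
    {f₀ : (Fin n → ℝ) → (Fin n → ℝ)} {f : Fin k → (Fin n → ℝ) → (Fin n → ℝ)}
    {g : (Fin n → ℝ) → Matrix (Fin n) (Fin d) ℝ}
    {hf₀ : ContDiffOn ℝ ∞ f₀ M} {hf : ∀ i, ContDiffOn ℝ ∞ (f i) M}
    {hg : ∀ a b, ContDiffOn ℝ ∞ (fun m => g m a b) M}

/-- The projection `(m, A) ↦ (m, A Aᵀ)` from frames to states. -/
noncomputable def project (p : (Fin n → ℝ) × EndR n) :
    (Fin n → ℝ) × Matrix (Fin n) (Fin n) ℝ :=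
  (p.1, mat n (p.2 * tr n p.2))

lemma project_mem {p : (Fin n → ℝ) × EndR n} (hp : p ∈ (liftedSystem hM hf₀ hf hg).dom) :
    project p ∈ stateSpace M := by
  refine ⟨hp.1, ?_⟩
  have h : (mat n p.2 * (mat n p.2).conjTranspose).PosSemidef :=
    Matrix.posSemidef_self_mul_conjTranspose _
  have hu : IsUnit (mat n p.2) := hp.2.map (mat n)
  rw [Matrix.conjTranspose_eq_transpose_of_trivial] at h
  have h2 := h.posDef_iff_isUnit.2 (hu.mul (by
    rw [← Matrix.isUnit_transpose] at hu
    exact hu))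
  simpa only [project, map_mul, mat_tr] using h2

/-- The derivative of `A ↦ A Aᵀ`. -/
noncomputable def gramDeriv (A H : EndR n) : EndR n := H * tr n A + A * tr n H

lemma hasDerivAt_project {γ : ℝ → (Fin n → ℝ) × EndR n} {γ' : (Fin n → ℝ) × EndR n} {t : ℝ}
    (h : HasDerivAt γ γ' t) :
    HasDerivAt (fun s => project (γ s)) (γ'.1, mat n (gramDeriv (γ t).2 γ'.2)) t := by
  have h1 : HasDerivAt (fun s => (γ s).1) γ'.1 t :=
    (ContinuousLinearMap.fst ℝ (Fin n → ℝ) (EndR n)).hasFDerivAt.comp_hasDerivAt t h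
  have h2 : HasDerivAt (fun s => (γ s).2) γ'.2 t :=
    (ContinuousLinearMap.snd ℝ (Fin n → ℝ) (EndR n)).hasFDerivAt.comp_hasDerivAt t h
  have h3 := h2.mul ((tr n).hasFDerivAt.comp_hasDerivAt t h2)
  have h4 := (LinearMap.toContinuousLinearMap (mat n).toLinearMap).hasFDerivAt.comp_hasDerivAt t h3
  exact h1.prodMk h4

lemma gramDeriv_add (A H K : EndR n) : gramDeriv A (H + K) = gramDeriv A H + gramDeriv A K := by
  simp only [gramDeriv, map_add, add_mul, mul_add]
  abel

lemma gramDeriv_smul (A H : EndR n) (c : ℝ) : gramDeriv A (c • H) = c • gramDeriv A H := by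
  simp only [gramDeriv, map_smul, smul_add, smul_mul_assoc, mul_smul_comm]

lemma gramDeriv_mul (A H : EndR n) :
    gramDeriv A (H * A) = H * (A * tr n A) + (A * tr n A) * tr n H := by
  simp only [gramDeriv, tr_mul, mul_assoc]

lemma gramDeriv_rotation (A B : EndR n) : gramDeriv A (A * (B - tr n B)) = 0 := by
  simp only [gramDeriv, tr_mul, map_sub, tr_tr, mul_assoc]
  rw [← mul_add, ← add_mul]
  simp

lemma project_lift (W : (Fin n → ℝ) → (Fin n → ℝ)) (p : (Fin n → ℝ) × EndR n) :
    ((lift W p).1, mat n (gramDeriv p.2 (lift W p).2)) = controlField W (project p) := by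
  refine Prod.ext rfl ?_
  show mat n (gramDeriv p.2 (fderiv ℝ W p.1 * p.2)) = _
  simp only [gramDeriv_mul, map_add, map_mul, mat_tr, mat_fderiv, controlField, project]

lemma project_rotation (B : EndR n) (p : (Fin n → ℝ) × EndR n) :
    ((rotation B p).1, mat n (gramDeriv p.2 (rotation B p).2)) = 0 := by
  refine Prod.ext rfl ?_
  show mat n (gramDeriv p.2 (p.2 * (B - tr n B))) = _
  simp [gramDeriv_rotation]

/-- The term `½ G A⁻ᵀ` contributes `½ G` and its transpose to the derivative of `A Aᵀ`, which add up
to the symmetric matrix `G = g gᵀ`. -/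
lemma project_liftedDrift {p : (Fin n → ℝ) × EndR n} (hp : IsUnit p.2) :
    ((liftedDrift f₀ g p).1, mat n (gramDeriv p.2 (liftedDrift f₀ g p).2)) =
      driftField f₀ g (project p) := by
  refine Prod.ext rfl ?_
  set G : EndR n := (mat n).symm (g p.1 * (g p.1).transpose) with hG
  have hmG : mat n G = g p.1 * (g p.1).transpose := (mat n).apply_symm_apply _
  have hGt : tr n G = G := by
    apply (mat n).injective
    rw [mat_tr, hmG]
    simp
  have h1 : gramDeriv p.2 ((1 / 2 : ℝ) • (G * tr n (Ring.inverse p.2))) = G := by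
    rw [gramDeriv_smul, gramDeriv, tr_mul, tr_tr, mul_assoc, ← tr_mul,
      Ring.mul_inverse_cancel _ hp, tr_one, mul_one, ← mul_assoc, Ring.mul_inverse_cancel _ hp,
      one_mul, hGt]
    module
  show mat n (gramDeriv p.2 (fderiv ℝ f₀ p.1 * p.2 +
    (1 / 2 : ℝ) • (G * tr n (Ring.inverse p.2)))) = _
  rw [gramDeriv_add, h1]
  simp only [gramDeriv_mul, map_add, map_mul, mat_tr, mat_fderiv, driftField, project, hmG]

lemma project_mem_reachableSet_of_arc {ε θ : ℝ} (hε : 0 < ε) {j : Fin k ⊕ EndR n}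
    {x y : (Fin n → ℝ) × EndR n}
    (h : Arc (liftedSystem hM hf₀ hf hg).dom (ε • (liftedSystem hM hf₀ hf hg).drift +
      θ • (liftedSystem hM hf₀ hf hg).ctrl j) x y) :
    project y ∈ reachableSet (stateSpace M) (statLinearization f₀ f g) (project x) ε := by
  obtain ⟨γ, rfl, rfl, hγ⟩ := h
  have hdiv : MapsTo (fun t : ℝ => t / ε) (Icc 0 ε) (Icc 0 1) := fun t ht =>
    ⟨div_nonneg ht.1 hε.le, (div_le_one hε).2 ht.2⟩
  -- Slowing the arc to duration `ε` normalizes the drift coefficient to `1` and the control to `θ /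
  -- ε`; a rotation is invisible downstairs, so its control is `0`.
  refine ⟨fun _ => Sum.elim (fun i => Pi.single i (θ / ε)) (fun _ => 0) j,
    fun t => project (γ (t / ε)), ⟨?_, fun t ht => project_mem (hγ _ (hdiv ht)).1, ∅,
    fun t ht _ => ⟨Eventually.of_forall fun _ => rfl, ?_⟩⟩, by simp, by simp [hε.ne']⟩
  · have hγc : ContinuousOn γ (Icc 0 1) := fun t ht => (hγ t ht).2.continuousWithinAt
    have h1 : Continuous (project (n := n)) := by
      have hmat : Continuous (mat n) :=
        LinearMap.continuous_of_finiteDimensional (mat n).toLinearMap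
      unfold project
      fun_prop
    exact h1.comp_continuousOn (hγc.comp (by fun_prop) hdiv)
  · have htm : t / ε ∈ Ioo (0 : ℝ) 1 := ⟨div_pos ht.1 hε, (div_lt_one hε).2 ht.2⟩
    obtain ⟨hdom, hder⟩ := hγ _ (Ioo_subset_Icc_self htm)
    have h1 := hder.hasDerivAt (Icc_mem_nhds htm.1 htm.2)
    have h2 : HasDerivAt (fun t : ℝ => t / ε) (1 / ε) t := (hasDerivAt_id t).div_const ε
    have h3 := hasDerivAt_project (h1.scomp t h2)
    set p := γ (t / ε) with hp
    have key : statLinearization f₀ f g (project p)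
        (Sum.elim (fun i => Pi.single i (θ / ε)) (fun _ => 0) j) =
        driftField f₀ g (project p) + (θ / ε) •
          ((((liftedSystem hM hf₀ hf hg).ctrl j p).1,
            mat n (gramDeriv p.2 ((liftedSystem hM hf₀ hf hg).ctrl j p).2)) :
            (Fin n → ℝ) × Matrix (Fin n) (Fin n) ℝ) := by
      rcases j with i | B
      · have e := project_lift (f i) p
        show _ + ∑ i', _ = _ + (θ / ε) • ((lift (f i) p).1, mat n (gramDeriv p.2 (lift (f i) p).2))
        rw [e, Finset.sum_eq_single i]
        · simp
        · intro b _ hb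
          simp [Pi.single_eq_of_ne hb]
        · simp
      · have e := project_rotation B p
        show _ + ∑ i', _ = _ + (θ / ε) • ((rotation B p).1, mat n (gramDeriv p.2 (rotation B p).2))
        rw [e]
        simp
    have e : (1 / ε) • (ε • (liftedSystem hM hf₀ hf hg).drift +
        θ • (liftedSystem hM hf₀ hf hg).ctrl j) p =
        liftedDrift f₀ g p + (θ / ε) • (liftedSystem hM hf₀ hf hg).ctrl j p := by
      simp only [Pi.add_apply, Pi.smul_apply, smul_add, smul_smul]
      rw [one_div, inv_mul_cancel₀ hε.ne', one_smul, inv_mul_eq_div]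
      rfl
    rw [e] at h3
    have e' : statLinearization f₀ f g (project p)
        (Sum.elim (fun i => Pi.single i (θ / ε)) (fun _ => 0) j) =
        ((liftedDrift f₀ g p + (θ / ε) • (liftedSystem hM hf₀ hf hg).ctrl j p).1,
          mat n (gramDeriv p.2
            (liftedDrift f₀ g p + (θ / ε) • (liftedSystem hM hf₀ hf hg).ctrl j p).2)) := by
      rw [key, ← project_liftedDrift hdom.2]
      refine Prod.ext rfl ?_
      show _ + _ = mat n (gramDeriv p.2 ((liftedDrift f₀ g p).2 +
        (θ / ε) • ((liftedSystem hM hf₀ hf hg).ctrl j p).2))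
      rw [gramDeriv_add, gramDeriv_smul, map_add, map_smul]
      rfl
    rw [e']
    exact h3

lemma project_mem_reachableSet_of_chain {ε : ℝ} (hε : 0 < ε) {ℓ : ℕ}
    {x y : (Fin n → ℝ) × EndR n} (h : (liftedSystem hM hf₀ hf hg).Chain ε ℓ x y) :
    project y ∈ reachableSet (stateSpace M) (statLinearization f₀ f g) (project x) (ℓ * ε) := by
  induction h with
  | nil hx => simpa using mem_reachableSet_zero (project_mem hx)
  | @cons ℓ x y z j θ h _ ih =>
    have e : ((ℓ + 1 : ℕ) : ℝ) * ε = ε + ℓ * ε := by push_cast; ring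
    rw [e]
    exact reachableSet_trans hε.le (by positivity) (project_mem_reachableSet_of_arc hε h) ih

end Projection

/-- Every state is reached from every other one in any sufficiently small time. -/
theorem exists_forall_mem_reachableSet {n d k : ℕ} {M : Set (Fin n → ℝ)} (hM : IsOpen M)
    (hM_conn : IsPreconnected M) {f₀ : (Fin n → ℝ) → (Fin n → ℝ)}
    {f : Fin k → (Fin n → ℝ) → (Fin n → ℝ)} {g : (Fin n → ℝ) → Matrix (Fin n) (Fin d) ℝ}
    (hf₀ : ContDiffOn ℝ ∞ f₀ M) (hf : ∀ i, ContDiffOn ℝ ∞ (f i) M)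
    (hg : ∀ a b, ContDiffOn ℝ ∞ (fun m => g m a b) M)
    (hrank : ∀ m ∈ M,
      Module.finrank ℝ (StatLin.lieOneJet (Set.range f) m) = n + n * (n + 1) / 2)
    {x y : (Fin n → ℝ) × Matrix (Fin n) (Fin n) ℝ} (hx : x ∈ stateSpace M)
    (hy : y ∈ stateSpace M) :
    ∃ T₀ > 0, ∀ T, 0 < T → T < T₀ →
      y ∈ reachableSet (stateSpace M) (statLinearization f₀ f g) x T := by
  have hdir : ∀ m (hz : (m, (1 : EndR n)) ∈ (liftedSystem hM hf₀ hf hg).dom),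
      (liftedSystem hM hf₀ hf hg).directions hz = ⊤ := fun m hz => directions_eq_top hrank hz
  have hN : ∀ m ∈ M, ∀ᶠ y in 𝓝 (m, (1 : EndR n)), (liftedSystem hM hf₀ hf hg).Orbit (m, 1) y :=
    fun m hm => ControlSystem.eventually_orbit (S := liftedSystem hM hf₀ hf hg)
      ⟨hm, isUnit_one⟩ (hdir m _)
  obtain ⟨A, hA, hA'⟩ := exists_orbit_of_posDef hM_conn hN hx.1 hx.1 hx.2
  obtain ⟨B, hB, hB'⟩ := exists_orbit_of_posDef hM_conn hN hx.1 hy.1 hy.2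
  -- The path passes through the frame `(x.1, 1)`, where all directions are available.
  obtain ⟨ℓ, hℓ, hch⟩ := ControlSystem.exists_chain_of_orbit hA'.symm hB' (hdir _ _)
  have hpx : project (x.1, A) = x := Prod.ext rfl (by simp [project, mat_tr, hA])
  have hpy : project (y.1, B) = y := Prod.ext rfl (by simp [project, mat_tr, hB])
  obtain ⟨δ, hδ, h⟩ := Metric.eventually_nhds_iff.1 hch
  have hℓ' : (0 : ℝ) < ℓ := Nat.cast_pos.2 hℓ
  -- Each of the `ℓ` arcs takes time `ε`, so `ε = T / ℓ`.
  refine ⟨ℓ * δ, by positivity, fun T hT hTδ => ?_⟩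
  have hch' := h (y := T / ℓ) (by
    rw [dist_zero_right, Real.norm_eq_abs, abs_of_pos (by positivity)]
    rwa [div_lt_iff₀' hℓ'])
  have hr := project_mem_reachableSet_of_chain (by positivity) hch'
  rwa [hpx, hpy, mul_div_cancel₀ _ hℓ'.ne'] at hr

end StatLin

theorem mainTheorem6 {n d k : ℕ} (M : Set (Fin n → ℝ)) (hM_open : IsOpen M)
    (hM_conn : IsConnected M)
    (f₀ : (Fin n → ℝ) → (Fin n → ℝ)) (f : Fin k → (Fin n → ℝ) → (Fin n → ℝ))
    (g : (Fin n → ℝ) → Matrix (Fin n) (Fin d) ℝ)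
    (hf₀ : ContDiffOn ℝ ∞ f₀ M) (hf : ∀ i, ContDiffOn ℝ ∞ (f i) M)
    (hg : ∀ a b, ContDiffOn ℝ ∞ (fun m => g m a b) M)
    (hrank : ∀ m ∈ M,
      Module.finrank ℝ (StatLin.lieOneJet (Set.range f) m) = n + n * (n + 1) / 2) :
    StatLin.ControllableFreeAndFixedTime (StatLin.stateSpace M)
      (StatLin.statLinearization f₀ f g) := by
  have key := fun {x y : (Fin n → ℝ) × Matrix (Fin n) (Fin n) ℝ} (hx : x ∈ StatLin.stateSpace M)
    (hy : y ∈ StatLin.stateSpace M) => StatLin.exists_forall_mem_reachableSet hM_open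
      hM_conn.isPreconnected hf₀ hf hg hrank hx hy
  intro x hx
  refine ⟨Set.Subset.antisymm
    (Set.iUnion₂_subset fun T hT => StatLin.reachableSet_subset hT) fun y hy => ?_, ?_⟩
  · obtain ⟨T₀, hT₀, h⟩ := key hx hy
    exact Set.mem_iUnion₂.2 ⟨T₀ / 2, (half_pos hT₀).le, h _ (half_pos hT₀) (half_lt_self hT₀)⟩
  · obtain ⟨T₀, hT₀, h⟩ := key hx hx
    refine ⟨T₀, hT₀, fun T hT hTT₀ => Set.Subset.antisymm (StatLin.reachableSet_subset hT.le)
      fun y hy => ?_⟩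
    obtain ⟨T₁, hT₁, h'⟩ := key hx hy
    -- Halving keeps both the loop and the final leg of positive duration.
    have hm : 0 < min T T₁ / 2 := by positivity
    have h1 : min T T₁ / 2 < T := (half_lt_self (lt_min hT hT₁)).trans_le (min_le_left _ _)
    have h2 : min T T₁ / 2 < T₁ := (half_lt_self (lt_min hT hT₁)).trans_le (min_le_right _ _)
    have := StatLin.reachableSet_trans (T₁ := T - min T T₁ / 2) (by linarith) hm.le
      (h _ (by linarith) (by linarith)) (h' _ hm h2)
    rwa [sub_add_cancel] at this
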